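/- Let $n\ge 2$, $\mathbb R^n_\pm=\{x\in\mathbb R^n: \pm x_1>0\}$ and $\Gamma=\{x\in\mathbb R^n: x_1=0\}$. For $1\le q<\infty$ let $D^{1,q}_0(\mathbb R^n)$ be the closure of $C_0^\infty(\mathbb R^n)$ in the norm $\|\nabla u\|_q$, realised as a space of locally integrable functions $u$ modulo constants with weak gradient $\nabla u\in L^q(\mathbb R^n)^n$. For $p>1$ put $\mathfrak D_{2,p+1}=D^{1,2}_0(\mathbb R^n)\cap D^{1,p+1}_0(\mathbb R^n)$. Let $\epsilon_1,\epsilon_f:\mathbb R^n\to\mathbb R$, $f:\mathbb R^n\to\mathbb R^n$ and $U_0:\mathbb R^n\to\mathbb R^n$ satisfy the following assumptions. (H0) $\epsilon_1,\epsilon_f\in L^\infty(\mathbb R^n)$ and $\epsilon_1,\epsilon_f\ge d>0$ a.e. for a constant $d$. (F0) There is a convex $F\in C^1(\mathbb R^n)$ with $F(0)=0$, $f=\nabla F$, and $F(v)\ge\mu_p|v|^{p+1}$ for all $v$ and some $\mu_p>0$. (F1) There are $1<\alpha\le p$, $0<\lambda_p\le\Lambda_p$ and $\Lambda_\alpha\ge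 0$ such that, for all $v\in\mathbb R^n$, $|f(v)|\le\Lambda_p|v|^p+\Lambda_\alpha|v|^\alpha$ and $f(v)\cdot v\ge\lambda_p|v|^{p+1}$. (A0) $U_0\in L^2(\mathbb R^n)^n\cap L^{p+1}(\mathbb R^n)^n$. (A1) The weak divergence of $\epsilon_1U_0$ in $\mathbb R^n_+\cup\mathbb R^n_-$ is a function $b\in L^2(\mathbb R^n)$ with $|||b|||<\infty$, where $|||b|||=\int\log(2+|x|)\,|b(x)|\,dx$ if $n=2$ and $|||b|||=\|b\|_{2n/(n+2)}$ if $n\ge3$. (A2) $\phi=0$ is not a weak solution in the sense of $(*)$ below, and $\epsilon_1U_0\cdot e_1$ has no jump across $\Gamma$ in the trace sense, i.e. $$-\int_{\mathbb R^n_+}\big(b\,\psi_++\epsilon_1U_0\cdot\nabla\psi_+\big)=\int_{\mathbb R^n_-}\big(b\,\psi_-+\epsilon_1U_0\cdot\nabla\psi_-\big)$$ for all $\psi_\pm\in C_0^\infty(\mathbb R^n)$ with $\psi_+=\psi_-$ on $\Gamma$. Then the energy $$\mathcal J(\phi)=\int\epsilon_fF(U_0+\nabla\phi)+\int\epsilon_1\frac{|\nabla\phi|^2}{2}+\int\epsilon_1U_0\cdot\nabla\phi$$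 is well defined (all three integrals converge absolutely) on $\mathfrak D_{2,p+1}$, and there is a $\phi\in\mathfrak D_{2,p+1}$ which is nontrivial ($\nabla\phi\ne0$ on a set of positive measure), is a global minimiser of $\mathcal J$ on $\mathfrak D_{2,p+1}$, and is a weak solution of the quasilinear transmission problem $\nabla\cdot\big(\epsilon_1(U_0+\nabla\phi)+\epsilon_ff(U_0+\nabla\phi)\big)=0$, i.e. $$(*)\qquad \int\epsilon_ff(U_0+\nabla\phi)\cdot\nabla\eta+\int\epsilon_1(U_0+\nabla\phi)\cdot\nabla\eta=0\qquad\text{for all }\eta\in\mathfrak D_{2,p+1}.$$ Moreover $$\int|\nabla\phi|^2+\int|U_0+\nabla\phi|^{p-1}|\nabla\phi|^2\le C\left(\|U_0\|_{p+1}^{p+1}+\|U_0\|_{\alpha+1}^{\alpha+1}+\|b\|_2^2+|||b|||^2\right),$$ where $C$ depends only on $n$, $p$, $\Lambda_p$, $\lambda_p$, $\Lambda_\alpha$, $d$ and (upper bounds for) $\|\epsilon_1\|_\infty$, $\|\epsilon_f\|_\infty$. In particular the bound does not involve $\|U_0\|_2$. -/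

import Mathlib

open MeasureTheory
open scoped ENNReal NNReal

/-- The space `ℝⁿ` with its Euclidean norm. -/
abbrev Rn (n : ℕ) : Type := EuclideanSpace ℝ (Fin n)

/-- `η ∈ C_0^∞(ℝⁿ)`: smooth with compact support. -/
def IsTestFunction {n : ℕ} (η : Rn n → ℝ) : Prop :=
  ContDiff ℝ (⊤ : ℕ∞) η ∧ HasCompactSupport η

/-- `u ∈ L¹_loc(ℝⁿ)` has the weak (distributional) gradient `G ∈ L¹_loc(ℝⁿ)ⁿ`. -/
structure HasWeakGradient {n : ℕ} (u : Rn n → ℝ) (G : Rn n → Rn n) : Prop where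
  locallyIntegrable : LocallyIntegrable u volume
  locallyIntegrable_grad : LocallyIntegrable G volume
  integral_eq : ∀ η : Rn n → ℝ, IsTestFunction η →
    ∫ x, u x • gradient η x = -∫ x, η x • G x

open Classical in
/-- The weak gradient `∇u` (unique almost everywhere; `0` if there is none). -/
noncomputable def weakGradient {n : ℕ} (u : Rn n → ℝ) : Rn n → Rn n :=
  if h : ∃ G, HasWeakGradient u G then h.choose else 0

theorem weakGradient_spec {n : ℕ} {u : Rn n → ℝ} (h : ∃ G, HasWeakGradient u G) :
    HasWeakGradient u (weakGradient u) := by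
  unfold weakGradient
  rw [dif_pos h]
  exact h.choose_spec

/-- The homogeneous Sobolev space `D_0^{1,q}(ℝⁿ)`, the closure of `C_0^∞(ℝⁿ)` in the norm
`|u|_{1,q} = ‖∇u‖_q`. Its elements are represented by locally integrable functions; two functions
that differ by a constant represent the same element. -/
structure MemD0 {n : ℕ} (q : ℝ≥0∞) (u : Rn n → ℝ) : Prop where
  exists_grad : ∃ G, HasWeakGradient u G
  memLp_grad : MemLp (weakGradient u) q volume
  approx : ∀ δ : ℝ≥0∞, 0 < δ → ∃ η : Rn n → ℝ, IsTestFunction η ∧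
    eLpNorm (fun x => weakGradient u x - gradient η x) q volume ≤ δ

/-- The space `D_0^{1,2}(ℝⁿ) ∩ D_0^{1,p+1}(ℝⁿ)`. -/
def MemD {n : ℕ} (p : ℝ) (u : Rn n → ℝ) : Prop :=
  MemD0 2 u ∧ MemD0 (ENNReal.ofReal (p + 1)) u

/-- The energy `J(φ) = ∫ ε_f F(U₀+∇φ) + ∫ ε₁ |∇φ|²/2 + ∫ ε₁ U₀·∇φ`. -/
noncomputable def energy {n : ℕ} (ε₁ εf : Rn n → ℝ) (F : Rn n → ℝ) (U₀ : Rn n → Rn n)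
    (φ : Rn n → ℝ) : ℝ :=
  (∫ x, εf x * F (U₀ x + weakGradient φ x)) + (∫ x, ε₁ x * (‖weakGradient φ x‖ ^ 2 / 2))
    + ∫ x, ε₁ x * inner ℝ (U₀ x) (weakGradient φ x)

/-- The three integrals in `J(φ)` converge absolutely. -/
def EnergyFinite {n : ℕ} (ε₁ εf : Rn n → ℝ) (F : Rn n → ℝ) (U₀ : Rn n → Rn n)
    (φ : Rn n → ℝ) : Prop :=
  Integrable (fun x => εf x * F (U₀ x + weakGradient φ x)) volume ∧
  Integrable (fun x => ε₁ x * (‖weakGradient φ x‖ ^ 2 / 2)) volume ∧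
  Integrable (fun x => ε₁ x * inner ℝ (U₀ x) (weakGradient φ x)) volume

/-- `φ` is a weak solution of `∇·D(x, U₀+∇φ) = 0`, where `D(x, E) = ε₁(x) E + ε_f(x) f(E)`. -/
def IsWeakSolution {n : ℕ} (p : ℝ) (ε₁ εf : Rn n → ℝ) (f : Rn n → Rn n) (U₀ : Rn n → Rn n)
    (φ : Rn n → ℝ) : Prop :=
  MemD p φ ∧ ∀ η : Rn n → ℝ, MemD p η →
    (∫ x, εf x * inner ℝ (f (U₀ x + weakGradient φ x)) (weakGradient η x))
      + (∫ x, ε₁ x * inner ℝ (U₀ x + weakGradient φ x) (weakGradient η x)) = 0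

/-- The half space `{x₁ > 0}`. -/
def halfPos (n : ℕ) [NeZero n] : Set (Rn n) := {x | 0 < x 0}

/-- The half space `{x₁ < 0}`. -/
def halfNeg (n : ℕ) [NeZero n] : Set (Rn n) := {x | x 0 < 0}

/-- On the open set `Ω`, the weak divergence of `V ∈ L¹_loc(Ω)ⁿ` is `g ∈ L¹_loc(Ω)`. -/
structure HasWeakDivOn {n : ℕ} (Ω : Set (Rn n)) (V : Rn n → Rn n) (g : Rn n → ℝ) : Prop where
  locallyIntegrableOn : LocallyIntegrableOn V Ω volume
  locallyIntegrableOn_div : LocallyIntegrableOn g Ω volume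
  integral_eq : ∀ η : Rn n → ℝ, IsTestFunction η → tsupport η ⊆ Ω →
    ∫ x in Ω, inner ℝ (V x) (gradient η x) = -∫ x in Ω, g x * η x

/-- The trace `(T₊ V)[ψ]` of `V·e₁` on `Γ = {x₁ = 0}` from `{x₁ > 0}`, where `g = ∇·V` and `ψext`
is an extension of `ψ`. -/
noncomputable def tracePos {n : ℕ} [NeZero n] (V : Rn n → Rn n) (g : Rn n → ℝ)
    (ψext : Rn n → ℝ) : ℝ :=
  -∫ x in halfPos n, (g x * ψext x + inner ℝ (V x) (gradient ψext x))

/-- The trace `(T₋ V)[ψ]` of `V·e₁` on `Γ = {x₁ = 0}` from `{x₁ < 0}`, where `g = ∇·V` and `ψext`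
is an extension of `ψ`. -/
noncomputable def traceNeg {n : ℕ} [NeZero n] (V : Rn n → Rn n) (g : Rn n → ℝ)
    (ψext : Rn n → ℝ) : ℝ :=
  ∫ x in halfNeg n, (g x * ψext x + inner ℝ (V x) (gradient ψext x))

/-- The transmission condition `⟦V·e₁⟧ = 0` in the trace sense: `T₊ V = T₋ V` on `C_0^∞(Γ)`. The
functions in `C_0^∞(Γ)` are the restrictions to `Γ` of test functions, and `u`, `v` are the
extensions used on the two sides. -/
def TransmissionCondition {n : ℕ} [NeZero n] (V : Rn n → Rn n) (g : Rn n → ℝ) : Prop :=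
  ∀ u v : Rn n → ℝ, IsTestFunction u → IsTestFunction v → (∀ x : Rn n, x 0 = 0 → u x = v x) →
    tracePos V g u = traceNeg V g v

/-- The norm `|||b|||`: `∫ log(2+|x|) |b(x)| dx` if `n = 2`, and `‖b‖_{2n/(n+2)}` if `n ≥ 3`. -/
noncomputable def tripleNorm {n : ℕ} (b : Rn n → ℝ) : ℝ≥0∞ :=
  if n = 2 then ∫⁻ x, ENNReal.ofReal (Real.log (2 + ‖x‖)) * ‖b x‖ₑ
  else eLpNorm b (ENNReal.ofReal (2 * n / (n + 2))) volume

/-- (H0): `ε₁, ε_f ∈ L^∞` and `ε₁, ε_f ≥ d > 0` almost everywhere. -/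
structure HypH0 {n : ℕ} (d : ℝ) (ε₁ εf : Rn n → ℝ) : Prop where
  d_pos : 0 < d
  memLp_one : MemLp ε₁ ⊤ volume
  memLp_f : MemLp εf ⊤ volume
  le_one : ∀ᵐ x, d ≤ ε₁ x
  le_f : ∀ᵐ x, d ≤ εf x

/-- (F0), for the potential `F` of `f`. -/
structure HypF0 {n : ℕ} (p : ℝ) (f : Rn n → Rn n) (F : Rn n → ℝ) : Prop where
  contDiff : ContDiff ℝ 1 F
  convex : ConvexOn ℝ Set.univ F
  map_zero : F 0 = 0
  grad : ∀ v, HasGradientAt F (f v) v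
  lower : ∃ μp : ℝ, 0 < μp ∧ ∀ v, μp * ‖v‖ ^ (p + 1) ≤ F v

/-- (F1). -/
structure HypF1 {n : ℕ} (p α lamp Lamp Lama : ℝ) (f : Rn n → Rn n) : Prop where
  one_lt : 1 < α
  le_p : α ≤ p
  lamp_pos : 0 < lamp
  lamp_le : lamp ≤ Lamp
  Lama_nonneg : 0 ≤ Lama
  upper : ∀ v, ‖f v‖ ≤ Lamp * ‖v‖ ^ p + Lama * ‖v‖ ^ α
  lower : ∀ v, lamp * ‖v‖ ^ (p + 1) ≤ inner ℝ (f v) v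

/-- (A0): `U₀ ∈ L² ∩ L^{p+1}`. -/
structure HypA0 {n : ℕ} (p : ℝ) (U₀ : Rn n → Rn n) : Prop where
  memLp_two : MemLp U₀ 2 volume
  memLp_p : MemLp U₀ (ENNReal.ofReal (p + 1)) volume

/-- (A1): `b = ∇·(ε₁U₀)` in both half spaces, `b ∈ L²` and `|||b||| < ∞`. -/
structure HypA1 {n : ℕ} [NeZero n] (ε₁ : Rn n → ℝ) (U₀ : Rn n → Rn n) (b : Rn n → ℝ) :
    Prop where
  div_pos : HasWeakDivOn (halfPos n) (fun x => ε₁ x • U₀ x) b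
  div_neg : HasWeakDivOn (halfNeg n) (fun x => ε₁ x • U₀ x) b
  memLp_two : MemLp b 2 volume
  triple_lt_top : tripleNorm b < ⊤

/-- (A2): `φ = 0` is not a weak solution, and `⟦ε₁U₀·e₁⟧ = 0`. -/
structure HypA2 {n : ℕ} [NeZero n] (p : ℝ) (ε₁ εf : Rn n → ℝ) (f : Rn n → Rn n)
    (U₀ : Rn n → Rn n) (b : Rn n → ℝ) : Prop where
  not_sol : ¬ IsWeakSolution p ε₁ εf f U₀ (fun _ => 0)
  transmission : TransmissionCondition (fun x => ε₁ x • U₀ x) b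

/-! Write `y = U₀ + ∇φ`. Adding the constant `∫ ε₁|U₀|²/2` turns the energy into the integral of a
density `ε_f F(y) + ε₁|y|²/2`, which is nonnegative, convex in `y` and bounded below by a multiple
of `|y|^(p+1) + |y|²`. The direct method applies to this form, and strong convergence replaces weak
compactness: among near minimisers of the energy one picks fields that also nearly minimise `N = ∫
|y|^(p+1) + |y|²`. Midpoints of near minimisers are again near minimisers, and Clarkson's inequality
makes `N` uniformly convex, so the sequence of gradients is Cauchy in `L²` and in `L^(p+1)`
(`exists_minimizing_seq`, `clarkson_rpow`). The limit is a gradient because `D_0^{1,2}` is complete: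
after subtraction of averages over the unit ball, a Poincaré inequality gives local `L²` convergence
of the potentials. Fatou's lemma gives minimality (`exists_minimizer`). Differentiating the energy
along lines gives the weak equation, and the minimiser is nontrivial because zero does not solve
that equation.

For the estimate, the equation is tested with `φ` itself. Two terms must be controlled without
`‖U₀‖₂`. In `f(y)·U₀` the quadratic part arises only where `|U₀|` is small compared with `|y|`;
there `|y| ≤ 2|∇φ|`, so it is absorbed by `∫ |∇φ|²` (`HypF1.young_le`). The linear term `∫ ε₁U₀·∇φ`
is bounded through `b` alone. The transmission condition makes `b` the divergence of `ε₁U₀` on the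
whole space, so the term equals `-∫ bφ` for test functions. If `n ≥ 3`, Hölder and Sobolev finish.

If `n = 2` there is no such Sobolev inequality. Instead `∫ b = 0`, since cutoffs at scale `k` have
bounded Dirichlet energy located far out, where the `L²` field has little mass. Hence a constant may
be subtracted from `φ`, and averages over unit balls drift at most like `log(2+|x|) ‖∇φ‖₂`, which is
the weight in `|||b|||`. The bound passes to the completion by density. -/

open Filter Topology

/-! ### Weak gradients and the homogeneous Sobolev spaces -/

section WeakGradient

variable {n : ℕ}

theorem norm_gradient_eq_norm_fderiv (u : Rn n → ℝ) (x : Rn n) :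
    ‖gradient u x‖ = ‖fderiv ℝ u x‖ := by
  simp [gradient]

theorem enorm_gradient_eq_enorm_fderiv (u : Rn n → ℝ) (x : Rn n) :
    ‖gradient u x‖ₑ = ‖fderiv ℝ u x‖ₑ := by
  rw [← ofReal_norm, ← ofReal_norm, norm_gradient_eq_norm_fderiv]

namespace IsTestFunction

variable {u v : Rn n → ℝ}

theorem continuous (hu : IsTestFunction u) : Continuous u := hu.1.continuous

theorem differentiable (hu : IsTestFunction u) : Differentiable ℝ u :=
  hu.1.differentiable (by simp)

theorem continuous_fderiv (hu : IsTestFunction u) : Continuous (fderiv ℝ u) :=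
  hu.1.continuous_fderiv (by simp)

theorem continuous_gradient (hu : IsTestFunction u) : Continuous (gradient u) :=
  (InnerProductSpace.toDual ℝ (Rn n)).symm.continuous.comp hu.continuous_fderiv

theorem hasCompactSupport_gradient (hu : IsTestFunction u) : HasCompactSupport (gradient u) :=
  (hu.2.fderiv ℝ).comp_left (g := (InnerProductSpace.toDual ℝ (Rn n)).symm) (map_zero _)

theorem memLp (hu : IsTestFunction u) (q : ℝ≥0∞) : MemLp u q volume :=
  hu.continuous.memLp_of_hasCompactSupport hu.2

theorem memLp_gradient (hu : IsTestFunction u) (q : ℝ≥0∞) : MemLp (gradient u) q volume :=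
  hu.continuous_gradient.memLp_of_hasCompactSupport hu.hasCompactSupport_gradient

theorem lincomb (hu : IsTestFunction u) (hv : IsTestFunction v) (a b : ℝ) :
    IsTestFunction (fun x => a * u x + b * v x) :=
  ⟨(contDiff_const.mul hu.1).add (contDiff_const.mul hv.1),
    (hu.2.mul_left (f := fun _ => a)).add (hv.2.mul_left (f := fun _ => b))⟩

theorem gradient_lincomb (hu : IsTestFunction u) (hv : IsTestFunction v) (a b : ℝ) (x : Rn n) :
    gradient (fun y => a * u y + b * v y) x = a • gradient u x + b • gradient v x := by
  have h : HasFDerivAt (fun y => a * u y + b * v y) (a • fderiv ℝ u x + b • fderiv ℝ v x) x :=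
    ((hu.differentiable x).hasFDerivAt.const_mul a).add
      ((hv.differentiable x).hasFDerivAt.const_mul b)
  simp [gradient, h.fderiv]

theorem zero : IsTestFunction (fun _ : Rn n => (0 : ℝ)) :=
  ⟨contDiff_const, HasCompactSupport.zero⟩

theorem integrable_smul {E : Type*} [NormedAddCommGroup E] [NormedSpace ℝ E] {w : Rn n → E}
    (hu : IsTestFunction u) (hw : LocallyIntegrable w volume) :
    Integrable (fun x => u x • w x) :=
  hw.integrable_smul_left_of_hasCompactSupport hu.continuous hu.2

theorem integrable_smul_gradient {w : Rn n → ℝ} (hu : IsTestFunction u)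
    (hw : LocallyIntegrable w volume) : Integrable (fun x => w x • gradient u x) :=
  hw.integrable_smul_right_of_hasCompactSupport hu.continuous_gradient
    hu.hasCompactSupport_gradient

end IsTestFunction

/-- Integration by parts in each fixed direction `v`; only the test function needs compact support.
The generality beyond test functions serves the completeness proof, where constants are subtracted
from test functions. -/
theorem ContDiff.hasWeakGradient {u : Rn n → ℝ} (hu : ContDiff ℝ 1 u) : HasWeakGradient u (gradient u) := by
  have hg : Continuous (gradient u) :=
    (InnerProductSpace.toDual ℝ (Rn n)).symm.continuous.comp (hu.continuous_fderiv one_ne_zero)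
  refine ⟨hu.continuous.locallyIntegrable, hg.locallyIntegrable, ?_⟩
  intro η hη
  refine ext_inner_left ℝ fun v => ?_
  have h1 := hη.integrable_smul_gradient hu.continuous.locallyIntegrable
  have h2 := hη.integrable_smul hg.locallyIntegrable
  rw [inner_neg_right, ← integral_inner h1, ← integral_inner h2]
  have key := integral_mul_fderiv_eq_neg_fderiv_mul_of_integrable (μ := (volume : Measure (Rn n)))
    (f := u) (g := η) (v := v) ?_ ?_ ?_ (fun x _ => hu.differentiable one_ne_zero x)
    (fun x _ => hη.differentiable x)
  · simp only [inner_smul_right, inner_gradient_right, conj_trivial]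
    rw [key]
    simp only [mul_comm]
  · have := h2.const_inner (𝕜 := ℝ) v
    simpa only [inner_smul_right, inner_gradient_right, conj_trivial, mul_comm] using this
  · have := h1.const_inner (𝕜 := ℝ) v
    simpa only [inner_smul_right, inner_gradient_right, conj_trivial] using this
  · have := hη.integrable_smul hu.continuous.locallyIntegrable
    simpa only [smul_eq_mul, mul_comm] using this

theorem IsTestFunction.hasWeakGradient {u : Rn n → ℝ} (hu : IsTestFunction u) :
    HasWeakGradient u (gradient u) :=
  (hu.1.of_le (by simp)).hasWeakGradient

namespace HasWeakGradient

variable {u v : Rn n → ℝ} {G H : Rn n → Rn n}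

theorem ae_eq (hG : HasWeakGradient u G) (hH : HasWeakGradient u H) : G =ᵐ[volume] H := by
  refine ae_eq_of_integral_contDiff_smul_eq hG.locallyIntegrable_grad hH.locallyIntegrable_grad ?_
  intro η h1 h2
  exact neg_injective ((hG.integral_eq η ⟨h1, h2⟩).symm.trans (hH.integral_eq η ⟨h1, h2⟩))

theorem weakGradient_ae_eq (hG : HasWeakGradient u G) : weakGradient u =ᵐ[volume] G :=
  (weakGradient_spec ⟨G, hG⟩).ae_eq hG

theorem lincomb (hG : HasWeakGradient u G) (hH : HasWeakGradient v H) (a b : ℝ) :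
    HasWeakGradient (fun x => a * u x + b * v x) (fun x => a • G x + b • H x) := by
  refine ⟨(hG.locallyIntegrable.smul a).add (hH.locallyIntegrable.smul b),
    (hG.locallyIntegrable_grad.smul a).add (hH.locallyIntegrable_grad.smul b), ?_⟩
  intro η hη
  have e1 : ∀ x, (a * u x + b * v x) • gradient η x
      = a • (u x • gradient η x) + b • (v x • gradient η x) := fun x => by module
  have e2 : ∀ x, η x • (a • G x + b • H x) = a • (η x • G x) + b • (η x • H x) :=
    fun x => by module
  have i1 : Integrable (fun x => a • (u x • gradient η x)) :=
    (hη.integrable_smul_gradient hG.locallyIntegrable).smul a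
  have i2 : Integrable (fun x => b • (v x • gradient η x)) :=
    (hη.integrable_smul_gradient hH.locallyIntegrable).smul b
  have i3 : Integrable (fun x => a • (η x • G x)) :=
    (hη.integrable_smul hG.locallyIntegrable_grad).smul a
  have i4 : Integrable (fun x => b • (η x • H x)) :=
    (hη.integrable_smul hH.locallyIntegrable_grad).smul b
  simp only [e1, e2]
  rw [integral_add i1 i2, integral_add i3 i4]
  simp only [integral_smul, hG.integral_eq η hη, hH.integral_eq η hη]
  module

end HasWeakGradient

/-- `G` is an `L^q` limit of gradients of test functions. -/
def IsLimitOfGradients (q : ℝ≥0∞) (G : Rn n → Rn n) : Prop :=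
  ∀ δ : ℝ≥0∞, 0 < δ → ∃ η : Rn n → ℝ, IsTestFunction η ∧
    eLpNorm (fun x => G x - gradient η x) q volume ≤ δ

theorem IsLimitOfGradients.congr {q : ℝ≥0∞} {G H : Rn n → Rn n} (h : IsLimitOfGradients q G)
    (hGH : G =ᵐ[volume] H) : IsLimitOfGradients q H := by
  intro δ hδ
  obtain ⟨η, hη, h⟩ := h δ hδ
  refine ⟨η, hη, le_of_eq_of_le (eLpNorm_congr_ae ?_) h⟩
  filter_upwards [hGH] with x hx
  rw [hx]

theorem IsLimitOfGradients.lincomb {q : ℝ≥0∞} (hq : 1 ≤ q) {G H : Rn n → Rn n}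
    (hG : IsLimitOfGradients q G) (hH : IsLimitOfGradients q H)
    (mG : AEStronglyMeasurable G volume) (mH : AEStronglyMeasurable H volume) (a b : ℝ) :
    IsLimitOfGradients q (fun x => a • G x + b • H x) := by
  intro δ hδ
  have hδ2 : 0 < δ / 2 := ENNReal.half_pos hδ.ne'
  -- The tolerance for each summand is `δ/2` divided by the size of its coefficient; a zero
  -- coefficient needs a separate choice.
  have small : ∀ c : ℝ, ∃ ε : ℝ≥0∞, 0 < ε ∧ ‖c‖ₑ * ε ≤ δ / 2 := by
    intro c
    rcases eq_or_ne c 0 with rfl | hc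
    · exact ⟨1, one_pos, by simp⟩
    · refine ⟨(δ / 2) / ‖c‖ₑ, ENNReal.div_pos hδ2.ne' (by simp), ?_⟩
      exact ENNReal.mul_div_le
  obtain ⟨ε, hε, hε'⟩ := small a
  obtain ⟨ε₂, hε₂, hε₂'⟩ := small b
  obtain ⟨η, hη, h⟩ := hG ε hε
  obtain ⟨ξ, hξ, h'⟩ := hH ε₂ hε₂
  refine ⟨_, hη.lincomb hξ a b, ?_⟩
  have e : (fun x => a • G x + b • H x - gradient (fun y => a * η y + b * ξ y) x)
      = a • (fun x => G x - gradient η x) + b • (fun x => H x - gradient ξ x) := by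
    funext x
    simp only [hη.gradient_lincomb hξ, Pi.add_apply, Pi.smul_apply]
    module
  have m1 : AEStronglyMeasurable (fun x => G x - gradient η x) volume :=
    mG.sub hη.continuous_gradient.aestronglyMeasurable
  have m2 : AEStronglyMeasurable (fun x => H x - gradient ξ x) volume :=
    mH.sub hξ.continuous_gradient.aestronglyMeasurable
  rw [e]
  calc _ ≤ eLpNorm (a • (fun x => G x - gradient η x)) q volume
        + eLpNorm (b • (fun x => H x - gradient ξ x)) q volume :=
        eLpNorm_add_le (m1.const_smul a) (m2.const_smul b) hq
    _ ≤ δ / 2 + δ / 2 := by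
        rw [eLpNorm_const_smul, eLpNorm_const_smul]
        exact add_le_add ((mul_le_mul_right h _).trans hε') ((mul_le_mul_right h' _).trans hε₂')
    _ = δ := ENNReal.add_halves δ

theorem IsLimitOfGradients.of_tendsto {q : ℝ≥0∞} (hq : 1 ≤ q) {G : ℕ → Rn n → Rn n}
    {H : Rn n → Rn n} (hG : ∀ k, IsLimitOfGradients q (G k))
    (mG : ∀ k, AEStronglyMeasurable (G k) volume) (mH : AEStronglyMeasurable H volume)
    (h : Tendsto (fun k => eLpNorm (G k - H) q volume) atTop (𝓝 0)) :
    IsLimitOfGradients q H := by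
  intro δ hδ
  have hδ2 : 0 < δ / 2 := ENNReal.half_pos hδ.ne'
  obtain ⟨k, hk⟩ := (h.eventually (gt_mem_nhds hδ2)).exists
  obtain ⟨η, hη, h'⟩ := hG k (δ / 2) hδ2
  refine ⟨η, hη, ?_⟩
  have e : (fun x => H x - gradient η x) = (H - G k) + (fun x => G k x - gradient η x) := by
    funext x
    simp
  rw [e]
  refine (eLpNorm_add_le (mH.sub (mG k))
    ((mG k).sub hη.continuous_gradient.aestronglyMeasurable) hq).trans ?_
  rw [eLpNorm_sub_comm]
  exact (add_le_add hk.le h').trans (ENNReal.add_halves δ).le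

theorem MemD0.of_hasWeakGradient {q : ℝ≥0∞} {u : Rn n → ℝ} {G : Rn n → Rn n}
    (h : HasWeakGradient u G) (hG : MemLp G q volume) (h' : IsLimitOfGradients q G) :
    MemD0 q u :=
  ⟨⟨G, h⟩, hG.ae_eq h.weakGradient_ae_eq.symm, h'.congr h.weakGradient_ae_eq.symm⟩

theorem MemD0.hasWeakGradient {q : ℝ≥0∞} {u : Rn n → ℝ} (h : MemD0 q u) :
    HasWeakGradient u (weakGradient u) :=
  weakGradient_spec h.exists_grad

theorem MemD0.lincomb {q : ℝ≥0∞} (hq : 1 ≤ q) {u v : Rn n → ℝ} (hu : MemD0 q u) (hv : MemD0 q v)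
    (a b : ℝ) : MemD0 q (fun x => a * u x + b * v x) :=
  .of_hasWeakGradient (hu.hasWeakGradient.lincomb hv.hasWeakGradient a b)
    ((hu.memLp_grad.const_smul a).add (hv.memLp_grad.const_smul b))
    (IsLimitOfGradients.lincomb hq hu.approx hv.approx hu.memLp_grad.1 hv.memLp_grad.1 a b)

theorem IsTestFunction.memD0 {u : Rn n → ℝ} (hu : IsTestFunction u) (q : ℝ≥0∞) : MemD0 q u :=
  .of_hasWeakGradient hu.hasWeakGradient (hu.memLp_gradient q)
    fun δ _ => ⟨u, hu, by simp⟩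

theorem IsTestFunction.memD {u : Rn n → ℝ} (hu : IsTestFunction u) (p : ℝ) : MemD p u :=
  ⟨hu.memD0 _, hu.memD0 _⟩

theorem MemD.lincomb {p : ℝ} (hp : 0 ≤ p) {u v : Rn n → ℝ} (hu : MemD p u) (hv : MemD p v)
    (a b : ℝ) : MemD p (fun x => a * u x + b * v x) :=
  ⟨hu.1.lincomb (by norm_num) hv.1 a b,
    hu.2.lincomb (by rw [ENNReal.one_le_ofReal]; linarith) hv.2 a b⟩

theorem MemD.weakGradient_lincomb {p : ℝ} {u v : Rn n → ℝ} (hu : MemD p u) (hv : MemD p v)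
    (a b : ℝ) : weakGradient (fun x => a * u x + b * v x)
      =ᵐ[volume] fun x => a • weakGradient u x + b • weakGradient v x :=
  (hu.1.hasWeakGradient.lincomb hv.1.hasWeakGradient a b).weakGradient_ae_eq

end WeakGradient

/-! ### Cauchy–Schwarz for averages -/

section SquareIntegrals

variable {α E : Type*} [MeasurableSpace α] {μ : Measure α}

theorem eLpNorm_two_sq [NormedAddCommGroup E] (f : α → E) :
    eLpNorm f 2 μ ^ 2 = ∫⁻ x, ‖f x‖ₑ ^ 2 ∂μ := by
  have := eLpNorm_nnreal_pow_eq_lintegral (f := f) (μ := μ) (p := 2) (by norm_num)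
  simpa using this

theorem sq_lintegral_le {f : α → ℝ≥0∞} (hf : AEMeasurable f μ) :
    (∫⁻ x, f x ∂μ) ^ 2 ≤ μ Set.univ * ∫⁻ x, f x ^ 2 ∂μ := by
  have h := ENNReal.lintegral_mul_le_Lp_mul_Lq μ Real.HolderConjugate.two_two
    (aemeasurable_const (b := (1 : ℝ≥0∞))) hf
  have h2 := pow_le_pow_left' h 2
  rw [mul_pow] at h2
  simp only [Pi.mul_apply, one_mul, ENNReal.one_rpow, lintegral_const] at h2
  have e : ∀ a : ℝ≥0∞, (a ^ (1 / (2 : ℝ))) ^ 2 = a := fun a => by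
    rw [← ENNReal.rpow_natCast, ← ENNReal.rpow_mul]; norm_num
  rw [e, e] at h2
  simpa using h2

variable [IsFiniteMeasure μ]

/-- The number `c - ⨍ u` is the average of `c - u`; Cauchy–Schwarz against the constant `1` applies,
and one factor of the finite nonzero total mass cancels. -/
theorem sq_enorm_sub_average_le {u : α → ℝ} (hu : Integrable u μ) (c : ℝ) :
    ‖c - ⨍ x, u x ∂μ‖ₑ ^ 2 * μ Set.univ ≤ ∫⁻ x, ‖c - u x‖ₑ ^ 2 ∂μ := by
  rcases eq_or_ne μ 0 with rfl | hμ
  · simp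
  have hμ0 : μ Set.univ ≠ 0 := by simpa using hμ
  have hμt : μ Set.univ ≠ ⊤ := measure_ne_top _ _
  have e : (μ.real Set.univ) * (c - ⨍ x, u x ∂μ) = ∫ x, (c - u x) ∂μ := by
    rw [integral_sub (integrable_const c) hu, average_eq, integral_const, smul_eq_mul,
      smul_eq_mul]
    have : μ.real Set.univ ≠ 0 := (ENNReal.toReal_pos hμ0 hμt).ne'
    field_simp
  have h1 : μ Set.univ * ‖c - ⨍ x, u x ∂μ‖ₑ ≤ ∫⁻ x, ‖c - u x‖ₑ ∂μ := by
    have h3 : ‖μ.real Set.univ‖ₑ = μ Set.univ := by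
      rw [Real.enorm_of_nonneg measureReal_nonneg, ofReal_measureReal]
    calc _ = ‖(μ.real Set.univ) * (c - ⨍ x, u x ∂μ)‖ₑ := by rw [enorm_mul, h3]
      _ ≤ _ := by rw [e]; exact enorm_integral_le_lintegral_enorm _
  have h2 := (pow_le_pow_left' h1 2).trans
    (sq_lintegral_le (aestronglyMeasurable_const.sub hu.1).enorm)
  have h4 : μ Set.univ * (‖c - ⨍ x, u x ∂μ‖ₑ ^ 2 * μ Set.univ)
      ≤ μ Set.univ * ∫⁻ x, ‖c - u x‖ₑ ^ 2 ∂μ := by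
    refine le_of_eq_of_le ?_ h2
    ring
  exact (ENNReal.mul_le_mul_iff_right hμ0 hμt).1 h4

/-- The previous bound is used once in each variable. No overlap of the two measures is needed, so
balls with different centres can be compared. -/
theorem sq_enorm_average_sub_average_le {ν : Measure α} [IsFiniteMeasure ν] {u : α → ℝ}
    (hu : Integrable u μ) (hu' : Integrable u ν) :
    ‖(⨍ x, u x ∂μ) - ⨍ x, u x ∂ν‖ₑ ^ 2 * (μ Set.univ * ν Set.univ)
      ≤ ∫⁻ x, ∫⁻ y, ‖u x - u y‖ₑ ^ 2 ∂ν ∂μ := by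
  have h := sq_enorm_sub_average_le hu (⨍ x, u x ∂ν)
  rw [← mul_assoc]
  rw [enorm_sub_rev] at h
  calc _ ≤ (∫⁻ x, ‖(⨍ x, u x ∂ν) - u x‖ₑ ^ 2 ∂μ) * ν Set.univ := mul_le_mul_left h _
    _ = ∫⁻ x, ‖u x - (⨍ x, u x ∂ν)‖ₑ ^ 2 * ν Set.univ ∂μ := by
        rw [lintegral_mul_const' _ _ (measure_ne_top _ _)]
        simp only [enorm_sub_rev]
    _ ≤ _ := lintegral_mono fun x => sq_enorm_sub_average_le hu' _

end SquareIntegrals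

/-! ### Difference quotients and Poincaré-type inequalities -/

section Translation

variable {n : ℕ} {u : Rn n → ℝ}

theorem IsTestFunction.integrable (hu : IsTestFunction u) : Integrable u :=
  memLp_one_iff_integrable.1 (hu.memLp 1)

instance isFiniteMeasure_restrict_ball_Rn (x : Rn n) (r : ℝ) :
    IsFiniteMeasure (volume.restrict (Metric.ball x r)) :=
  ⟨by simpa using measure_ball_lt_top⟩

/-- The increment is the integral of the derivative along the segment from `x` to `x + h`.
Cauchy–Schwarz in the segment parameter, Tonelli and translation invariance then give the constant
`|h|²`. -/
theorem IsTestFunction.lintegral_sq_translate_sub_le (hu : IsTestFunction u) (h : Rn n) :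
    ∫⁻ x, ‖u (x + h) - u x‖ₑ ^ 2 ≤ ‖h‖ₑ ^ 2 * ∫⁻ x, ‖gradient u x‖ₑ ^ 2 := by
  have cont : Continuous fun z : Rn n × ℝ => fderiv ℝ u (z.1 + z.2 • h) :=
    hu.continuous_fderiv.comp (by fun_prop)
  have key : ∀ x, ‖u (x + h) - u x‖ₑ ^ 2
      ≤ ‖h‖ₑ ^ 2 * ∫⁻ t in Set.Ioc (0 : ℝ) 1, ‖fderiv ℝ u (x + t • h)‖ₑ ^ 2 := by
    intro x
    have c1 : Continuous fun t : ℝ => fderiv ℝ u (x + t • h) :=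
      cont.comp (Continuous.prodMk_right x)
    have d : ∀ t : ℝ, HasDerivAt (fun t : ℝ => u (x + t • h)) (fderiv ℝ u (x + t • h) h) t := by
      intro t
      have d1 : HasDerivAt (fun t : ℝ => x + t • h) h t := by
        simpa using ((hasDerivAt_id t).smul_const h).const_add x
      exact (hu.differentiable _).hasFDerivAt.comp_hasDerivAt t d1
    have e := intervalIntegral.integral_eq_sub_of_hasDerivAt (a := 0) (b := 1)
      (fun t _ => d t) ((c1.clm_apply continuous_const).intervalIntegrable _ _)
    simp only [one_smul, zero_smul, add_zero] at e
    rw [← e, intervalIntegral.integral_of_le zero_le_one]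
    have m : AEMeasurable (fun t : ℝ => ‖fderiv ℝ u (x + t • h)‖ₑ)
        (volume.restrict (Set.Ioc (0 : ℝ) 1)) := c1.enorm.measurable.aemeasurable
    calc _ ≤ (∫⁻ t in Set.Ioc (0 : ℝ) 1, ‖fderiv ℝ u (x + t • h) h‖ₑ) ^ 2 :=
          pow_le_pow_left' (enorm_integral_le_lintegral_enorm _) 2
      _ ≤ (∫⁻ t in Set.Ioc (0 : ℝ) 1, ‖h‖ₑ * ‖fderiv ℝ u (x + t • h)‖ₑ) ^ 2 := by
          refine pow_le_pow_left' (lintegral_mono fun t => ?_) 2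
          rw [mul_comm]
          exact ContinuousLinearMap.le_opENorm _ _
      _ ≤ ‖h‖ₑ ^ 2 * ∫⁻ t in Set.Ioc (0 : ℝ) 1, ‖fderiv ℝ u (x + t • h)‖ₑ ^ 2 := by
          rw [lintegral_const_mul' _ _ enorm_ne_top, mul_pow]
          gcongr
          refine (sq_lintegral_le m).trans ?_
          simp
  calc _ ≤ ∫⁻ x, ‖h‖ₑ ^ 2 * ∫⁻ t in Set.Ioc (0 : ℝ) 1, ‖fderiv ℝ u (x + t • h)‖ₑ ^ 2 :=
        lintegral_mono key
    _ = ‖h‖ₑ ^ 2 * ∫⁻ t in Set.Ioc (0 : ℝ) 1, ∫⁻ x, ‖fderiv ℝ u (x + t • h)‖ₑ ^ 2 := by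
        rw [lintegral_const_mul' _ _ (by finiteness), lintegral_lintegral_swap]
        exact (cont.enorm.measurable.pow_const 2).aemeasurable
    _ = _ := by
        congr 1
        have : ∀ t : ℝ, ∫⁻ x, ‖fderiv ℝ u (x + t • h)‖ₑ ^ 2 = ∫⁻ x, ‖gradient u x‖ₑ ^ 2 := by
          intro t
          rw [lintegral_add_right_eq_self (fun x => ‖fderiv ℝ u x‖ₑ ^ 2) (t • h)]
          simp only [enorm_gradient_eq_enorm_fderiv]
        simp [this]

/-- With `y = x + h` one has `|h| < ρ`. Enlarging the domain to all `x` and all such `h` and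
exchanging the integrals leaves the translation estimate, integrated over the ball of radius `ρ`. -/
theorem IsTestFunction.lintegral_lintegral_sq_sub_le (hu : IsTestFunction u) {S T : Set (Rn n)}
    (hS : MeasurableSet S) (hT : MeasurableSet T) {ρ : ℝ}
    (h : ∀ x ∈ S, ∀ y ∈ T, dist y x < ρ) :
    ∫⁻ x in S, ∫⁻ y in T, ‖u x - u y‖ₑ ^ 2
      ≤ volume (Metric.ball (0 : Rn n) ρ) * ENNReal.ofReal ρ ^ 2 *
        ∫⁻ x, ‖gradient u x‖ₑ ^ 2 := by
  have hc : Continuous fun z : Rn n × Rn n => ‖u (z.1 + z.2) - u z.1‖ₑ :=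
    ((hu.continuous.comp (by fun_prop)).sub (hu.continuous.comp continuous_fst)).enorm
  have h1 : ∀ x ∈ S, ∫⁻ y in T, ‖u x - u y‖ₑ ^ 2
      ≤ ∫⁻ h in Metric.ball (0 : Rn n) ρ, ‖u (x + h) - u x‖ₑ ^ 2 := by
    intro x hx
    rw [← lintegral_indicator hT, ← lintegral_indicator Metric.isOpen_ball.measurableSet,
      ← lintegral_add_left_eq_self _ x]
    refine lintegral_mono fun y => ?_
    by_cases hy : x + y ∈ T
    · have : y ∈ Metric.ball (0 : Rn n) ρ := by simpa [dist_eq_norm] using h x hx _ hy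
      rw [Set.indicator_of_mem hy, Set.indicator_of_mem this, enorm_sub_rev]
    · simp [hy]
  calc _ ≤ ∫⁻ x in S, ∫⁻ h in Metric.ball (0 : Rn n) ρ, ‖u (x + h) - u x‖ₑ ^ 2 :=
        setLIntegral_mono' hS h1
    _ ≤ ∫⁻ x, ∫⁻ h in Metric.ball (0 : Rn n) ρ, ‖u (x + h) - u x‖ₑ ^ 2 := setLIntegral_le_lintegral _ _
    _ = ∫⁻ h in Metric.ball (0 : Rn n) ρ, ∫⁻ x, ‖u (x + h) - u x‖ₑ ^ 2 :=
        lintegral_lintegral_swap (hc.measurable.pow_const 2).aemeasurable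
    _ ≤ ∫⁻ h in Metric.ball (0 : Rn n) ρ, ENNReal.ofReal ρ ^ 2 * ∫⁻ x, ‖gradient u x‖ₑ ^ 2 := by
        refine setLIntegral_mono' Metric.isOpen_ball.measurableSet fun h hh => ?_
        refine (hu.lintegral_sq_translate_sub_le h).trans ?_
        gcongr
        rw [← ofReal_norm]
        exact ENNReal.ofReal_le_ofReal (by simpa using (Metric.mem_ball.1 hh).le)
    _ = _ := by
        rw [setLIntegral_const]
        ring

theorem IsTestFunction.sq_enorm_average_sub_average_le (hu : IsTestFunction u) {x y : Rn n}
    {r s ρ : ℝ} (h : r + s + dist x y ≤ ρ) :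
    ‖(⨍ z in Metric.ball x r, u z) - ⨍ z in Metric.ball y s, u z‖ₑ ^ 2 *
        (volume (Metric.ball x r) * volume (Metric.ball y s))
      ≤ volume (Metric.ball (0 : Rn n) ρ) * ENNReal.ofReal ρ ^ 2 *
        ∫⁻ x, ‖gradient u x‖ₑ ^ 2 := by
  have i := hu.integrable
  have := _root_.sq_enorm_average_sub_average_le (i.restrict (s := Metric.ball x r))
    (i.restrict (s := Metric.ball y s))
  simp only [Measure.restrict_apply_univ] at this
  refine this.trans (hu.lintegral_lintegral_sq_sub_le Metric.isOpen_ball.measurableSet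
    Metric.isOpen_ball.measurableSet fun a ha b hb => ?_)
  have h1 := dist_triangle4 b y x a
  rw [Metric.mem_ball] at ha hb
  rw [dist_comm x a, dist_comm y x] at h1
  linarith

theorem IsTestFunction.lintegral_ball_sq_sub_average_le (hu : IsTestFunction u) (R : ℝ) :
    (∫⁻ x in Metric.ball (0 : Rn n) R, ‖u x - ⨍ z in Metric.ball (0 : Rn n) 1, u z‖ₑ ^ 2) *
        volume (Metric.ball (0 : Rn n) 1)
      ≤ volume (Metric.ball (0 : Rn n) (R + 1)) * ENNReal.ofReal (R + 1) ^ 2 *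
        ∫⁻ x, ‖gradient u x‖ₑ ^ 2 := by
  have i := hu.integrable
  refine le_trans ?_ (hu.lintegral_lintegral_sq_sub_le
    (Metric.isOpen_ball (x := (0 : Rn n)) (ε := R)).measurableSet
    (Metric.isOpen_ball (x := (0 : Rn n)) (ε := 1)).measurableSet fun a ha b hb => ?_)
  · rw [← lintegral_mul_const' _ _ measure_ball_lt_top.ne]
    refine lintegral_mono fun x => ?_
    simpa using sq_enorm_sub_average_le (i.restrict (s := Metric.ball (0 : Rn n) 1)) (u x)
  · have := dist_triangle b 0 a
    rw [Metric.mem_ball] at ha hb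
    rw [dist_comm 0 a] at this
    linarith

end Translation

/-! ### Completeness of the homogeneous spaces -/

section Completeness

variable {n : ℕ}

theorem tendsto_integral_smul_of_tendsto_eLpNorm_two {α E : Type*} [MeasurableSpace α]
    {μ : Measure α} [NormedAddCommGroup E] [NormedSpace ℝ E] {f : ℕ → α → ℝ} {f₀ : α → ℝ}
    {w : α → E} (hf : ∀ k, MemLp (f k) 2 μ) (hf₀ : MemLp f₀ 2 μ) (hw : MemLp w 2 μ)
    (h : Tendsto (fun k => eLpNorm (f k - f₀) 2 μ) atTop (𝓝 0)) :
    Tendsto (fun k => ∫ x, f k x • w x ∂μ) atTop (𝓝 (∫ x, f₀ x • w x ∂μ)) := by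
  refine tendsto_integral_of_L1' _ (hf₀.1.smul hw.1)
    (Eventually.of_forall fun k => memLp_one_iff_integrable.1 (hw.smul (hf k))) ?_
  have h2 := ENNReal.Tendsto.mul_const (b := eLpNorm w 2 μ) h (Or.inr hw.2.ne)
  rw [zero_mul] at h2
  refine tendsto_of_tendsto_of_tendsto_of_le_of_le tendsto_const_nhds h2 (fun _ => zero_le) ?_
  intro k
  have e : ((fun x => f k x • w x) - fun x => f₀ x • w x) = (f k - f₀) • w := by
    funext x
    simp [sub_smul]
  change eLpNorm ((fun x => f k x • w x) - fun x => f₀ x • w x) 1 μ ≤ _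
  rw [e]
  exact eLpNorm_smul_le_mul_eLpNorm hw.1 ((hf k).1.sub hf₀.1)

theorem tendsto_integral_smul_of_tendsto_eLpNorm_two' {α E : Type*} [MeasurableSpace α]
    {μ : Measure α} [NormedAddCommGroup E] [NormedSpace ℝ E] {f : ℕ → α → E} {f₀ : α → E}
    {w : α → ℝ} (hf : ∀ k, MemLp (f k) 2 μ) (hf₀ : MemLp f₀ 2 μ) (hw : MemLp w 2 μ)
    (h : Tendsto (fun k => eLpNorm (f k - f₀) 2 μ) atTop (𝓝 0)) :
    Tendsto (fun k => ∫ x, w x • f k x ∂μ) atTop (𝓝 (∫ x, w x • f₀ x ∂μ)) := by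
  refine tendsto_integral_of_L1' _ (hw.1.smul hf₀.1)
    (Eventually.of_forall fun k => memLp_one_iff_integrable.1 ((hf k).smul hw)) ?_
  have h2 := ENNReal.Tendsto.const_mul (a := eLpNorm w 2 μ) h (Or.inr hw.2.ne)
  rw [mul_zero] at h2
  refine tendsto_of_tendsto_of_tendsto_of_le_of_le tendsto_const_nhds h2 (fun _ => zero_le) ?_
  intro k
  have e : ((fun x => w x • f k x) - fun x => w x • f₀ x) = w • (f k - f₀) := by
    funext x
    simp [smul_sub]
  change eLpNorm ((fun x => w x • f k x) - fun x => w x • f₀ x) 1 μ ≤ _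
  rw [e]
  exact eLpNorm_smul_le_mul_eLpNorm ((hf k).1.sub hf₀.1) hw.1

/-- A Poincaré inequality whose normalising average is taken over the unit ball for every `R`. One
constant per function then serves all radii, and the local limits fit together. -/
theorem exists_eLpNorm_sub_average_le (R : ℝ) : ∃ C : ℝ≥0, ∀ u : Rn n → ℝ, IsTestFunction u →
    eLpNorm (fun x => u x - ⨍ z in Metric.ball (0 : Rn n) 1, u z) 2
      (volume.restrict (Metric.ball (0 : Rn n) R)) ≤ C * eLpNorm (gradient u) 2 volume := by
  set V := volume (Metric.ball (0 : Rn n) 1) with hV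
  have hV0 : V ≠ 0 := (Metric.measure_ball_pos volume (0 : Rn n) one_pos).ne'
  have hVt : V ≠ ⊤ := measure_ball_lt_top.ne
  set K := volume (Metric.ball (0 : Rn n) (R + 1)) * ENNReal.ofReal (R + 1) ^ 2 / V with hK
  have hKt : K ≠ ⊤ := by
    refine ENNReal.div_ne_top (ENNReal.mul_ne_top measure_ball_lt_top.ne (by finiteness)) hV0
  refine ⟨(K ^ (1 / 2 : ℝ)).toNNReal, fun u hu => ?_⟩
  rw [ENNReal.coe_toNNReal (by finiteness)]
  have h := hu.lintegral_ball_sq_sub_average_le R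
  rw [← eLpNorm_two_sq, ← eLpNorm_two_sq, ← ENNReal.le_div_iff_mul_le (Or.inl hV0) (Or.inl hVt)] at h
  rw [← ENNReal.pow_le_pow_left_iff two_ne_zero]
  refine h.trans (le_of_eq ?_)
  rw [mul_pow, ← ENNReal.rpow_natCast (K ^ _), ← ENNReal.rpow_mul, hK]
  norm_num
  simp only [div_eq_mul_inv]
  ring

/-- The homogeneous space `D_0^{1,2}` is complete: every `L²` limit of gradients of test functions
is a weak gradient. -/
theorem IsLimitOfGradients.exists_hasWeakGradient {G : Rn n → Rn n}
    (hG : IsLimitOfGradients 2 G) (mG : MemLp G 2 volume) : ∃ u, HasWeakGradient u G := by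
  have hε : ∀ k : ℕ, (0 : ℝ≥0∞) < 2⁻¹ ^ k := fun k =>
    ENNReal.pow_pos (by simp) k
  choose η hη hη' using fun k => hG (2⁻¹ ^ k) (hε k)
  have hsum : ∑' k : ℕ, (2⁻¹ : ℝ≥0∞) ^ k ≠ ⊤ := by
    rw [ENNReal.tsum_geometric]
    simp
  have hanti : ∀ N k : ℕ, N ≤ k → (2⁻¹ : ℝ≥0∞) ^ k ≤ 2⁻¹ ^ N := fun N k h =>
    pow_le_pow_right_of_le_one' (by simp) h
  have grad_cauchy : ∀ N j k : ℕ, N ≤ j → N ≤ k →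
      eLpNorm (fun x => gradient (η j) x - gradient (η k) x) 2 volume ≤ 2 * 2⁻¹ ^ N := by
    intro N j k hj hk
    have e : (fun x => gradient (η j) x - gradient (η k) x)
        = (fun x => G x - gradient (η k) x) - (fun x => G x - gradient (η j) x) := by
      funext x
      simp
    rw [e, two_mul]
    refine (eLpNorm_sub_le (mG.1.sub (hη k).continuous_gradient.aestronglyMeasurable)
      (mG.1.sub (hη j).continuous_gradient.aestronglyMeasurable) (by norm_num)).trans ?_
    exact add_le_add ((hη' k).trans (hanti N k hk)) ((hη' j).trans (hanti N j hj))
  have grad_tendsto : Tendsto (fun k => eLpNorm (gradient (η k) - G) 2 volume) atTop (𝓝 0) := by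
    refine tendsto_of_tendsto_of_tendsto_of_le_of_le tendsto_const_nhds
      (ENNReal.tendsto_atTop_zero_of_tsum_ne_top hsum) (fun _ => zero_le) fun k => ?_
    rw [eLpNorm_sub_comm]
    exact hη' k
  -- The gradients fix the approximants only up to constants, so convergence of the functions
  -- requires a normalisation.
  set c : ℕ → ℝ := fun k => ⨍ z in Metric.ball (0 : Rn n) 1, η k z with hc
  set w : ℕ → Rn n → ℝ := fun k x => η k x - c k with hw
  have w_cont : ∀ k, Continuous (w k) := fun k => (hη k).continuous.sub continuous_const
  have w_mem : ∀ k R, MemLp (w k) 2 (volume.restrict (Metric.ball (0 : Rn n) R)) := fun k R =>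
    (((hη k).memLp 2).restrict _).sub (memLp_const _)
  have w_grad : ∀ k, HasWeakGradient (w k) (gradient (η k)) := by
    intro k
    have h1 : ContDiff ℝ 1 (w k) := ((hη k).1.of_le (by simp)).sub contDiff_const
    have h2 : gradient (w k) = gradient (η k) := by
      funext x
      simp only [gradient, hw, fderiv_sub_const]
    rw [← h2]
    exact h1.hasWeakGradient
  have w_cauchy : ∀ R : ℝ, ∃ B : ℕ → ℝ≥0∞, ∑' i, B i ≠ ⊤ ∧ ∀ N j k : ℕ, N ≤ j → N ≤ k →
      eLpNorm (w j - w k) 2 (volume.restrict (Metric.ball (0 : Rn n) R)) < B N := by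
    intro R
    obtain ⟨C, hC⟩ := exists_eLpNorm_sub_average_le (n := n) R
    -- The factor `2` comes from `grad_cauchy`; the extra `1` makes the inequality strict, and the
    -- geometric factor makes the bounds summable, as almost everywhere convergence requires.
    refine ⟨fun N => (C * 2 + 1) * 2⁻¹ ^ N, ?_, ?_⟩
    · rw [ENNReal.tsum_mul_left]
      exact ENNReal.mul_ne_top (by finiteness) hsum
    · intro N j k hj hk
      have h := hC _ ((hη j).lincomb (hη k) 1 (-1))
      have i : ∀ k, IntegrableOn (η k) (Metric.ball (0 : Rn n) 1) volume := fun k =>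
        (hη k).integrable.restrict
      have e1 : (fun x => 1 * η j x + -1 * η k x
          - ⨍ z in Metric.ball (0 : Rn n) 1, (1 * η j z + -1 * η k z)) = w j - w k := by
        funext x
        have : ⨍ z in Metric.ball (0 : Rn n) 1, (1 * η j z + -1 * η k z) = c j - c k := by
          simp only [hc, average_eq]
          rw [← smul_sub, ← integral_sub (i j) (i k)]
          simp [sub_eq_add_neg]
        rw [this]
        simp only [hw, Pi.sub_apply]
        ring
      have e2 : gradient (fun x => 1 * η j x + -1 * η k x)
          = fun x => gradient (η j) x - gradient (η k) x := by
        funext x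
        rw [(hη j).gradient_lincomb (hη k)]
        module
      rw [e1, e2] at h
      refine (h.trans (mul_le_mul_right (grad_cauchy N j k hj hk) _)).trans_lt ?_
      beta_reduce
      rw [← mul_assoc, add_mul, one_mul]
      refine ENNReal.lt_add_right ?_ (hε N).ne'
      have : (2⁻¹ : ℝ≥0∞) ^ N ≠ ⊤ := ENNReal.pow_ne_top (by simp)
      finiteness
  choose B hB hB' using w_cauchy
  have lim_ex : ∀ᵐ x : Rn n, ∃ l, Tendsto (fun k => w k x) atTop (𝓝 l) := by
    have h1 : ∀ R : ℕ, ∀ᵐ x : Rn n, x ∈ Metric.ball (0 : Rn n) R →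
        ∃ l, Tendsto (fun k => w k x) atTop (𝓝 l) := fun R =>
      (ae_restrict_iff' Metric.isOpen_ball.measurableSet).1 (Lp.ae_tendsto_of_cauchy_eLpNorm
        (fun k => (w_cont k).aestronglyMeasurable) (by norm_num) (hB R) (hB' R))
    filter_upwards [ae_all_iff.2 h1] with x hx
    obtain ⟨R, hR⟩ := exists_nat_gt ‖x‖
    exact hx R (by simpa using hR)
  obtain ⟨u, hu, hlim⟩ := exists_stronglyMeasurable_limit_of_tendsto_ae
    (fun k => (w_cont k).aestronglyMeasurable) lim_ex
  have u_tendsto : ∀ R : ℝ, Tendsto (fun k => eLpNorm (w k - u) 2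
      (volume.restrict (Metric.ball (0 : Rn n) R))) atTop (𝓝 0) := fun R =>
    Lp.cauchy_tendsto_of_tendsto (fun k => (w_cont k).aestronglyMeasurable) u (hB R) (hB' R)
      (ae_restrict_of_ae hlim)
  have u_mem : ∀ R : ℝ, MemLp u 2 (volume.restrict (Metric.ball (0 : Rn n) R)) := fun R =>
    Lp.memLp_of_cauchy_tendsto (by norm_num) (w_mem · R) u hu.aestronglyMeasurable (u_tendsto R)
  refine ⟨u, ?_, mG.locallyIntegrable (by norm_num), fun ξ hξ => ?_⟩
  · intro x
    exact ⟨Metric.ball 0 (‖x‖ + 1), Metric.isOpen_ball.mem_nhds (by simp),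
      (u_mem _).integrable (by norm_num)⟩
  -- The gradient of the test function lives in one ball, so local `L²` convergence of the functions
  -- suffices on the left of the identity, while the gradients converge globally.
  · obtain ⟨R, hR⟩ := hξ.hasCompactSupport_gradient.isBounded.subset_ball (0 : Rn n)
    have e : ∀ v : Rn n → ℝ, ∫ x in Metric.ball (0 : Rn n) R, v x • gradient ξ x
        = ∫ x, v x • gradient ξ x := by
      intro v
      refine setIntegral_eq_integral_of_forall_compl_eq_zero fun x hx => ?_
      rw [image_eq_zero_of_notMem_tsupport fun h => hx (hR h), smul_zero]
    have t1 := tendsto_integral_smul_of_tendsto_eLpNorm_two (fun k => w_mem k R) (u_mem R)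
      ((hξ.memLp_gradient 2).restrict _) (u_tendsto R)
    have t2 := tendsto_integral_smul_of_tendsto_eLpNorm_two' (fun k => (hη k).memLp_gradient 2) mG
      (hξ.memLp 2) grad_tendsto
    simp only [e, (w_grad _).integral_eq ξ hξ] at t1
    exact tendsto_nhds_unique t1 t2.neg

/-- The space `D_0^{1,2} ∩ D_0^{1,p+1}` is complete. -/
theorem exists_memD_of_tendsto {p : ℝ} (hp : 0 ≤ p) {ψ : ℕ → Rn n → ℝ} (hψ : ∀ k, MemD p (ψ k))
    {G : Rn n → Rn n} (mG : AEStronglyMeasurable G volume)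
    (h2 : Tendsto (fun k => eLpNorm (weakGradient (ψ k) - G) 2 volume) atTop (𝓝 0))
    (hq : Tendsto (fun k => eLpNorm (weakGradient (ψ k) - G) (ENNReal.ofReal (p + 1)) volume)
      atTop (𝓝 0)) :
    ∃ φ, MemD p φ ∧ weakGradient φ =ᵐ[volume] G := by
  have hq1 : 1 ≤ ENNReal.ofReal (p + 1) := by rw [ENNReal.one_le_ofReal]; linarith
  have m2 := Lp.memLp_of_cauchy_tendsto (by norm_num) (fun k => (hψ k).1.memLp_grad) G mG h2
  have mq := Lp.memLp_of_cauchy_tendsto hq1 (fun k => (hψ k).2.memLp_grad) G mG hq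
  have l2 : IsLimitOfGradients 2 G := .of_tendsto (by norm_num) (fun k => (hψ k).1.approx)
    (fun k => (hψ k).1.memLp_grad.1) mG h2
  have lq : IsLimitOfGradients (ENNReal.ofReal (p + 1)) G := .of_tendsto hq1
    (fun k => (hψ k).2.approx) (fun k => (hψ k).2.memLp_grad.1) mG hq
  obtain ⟨φ, hφ⟩ := l2.exists_hasWeakGradient m2
  exact ⟨φ, ⟨.of_hasWeakGradient hφ m2 l2, .of_hasWeakGradient hφ mq lq⟩, hφ.weakGradient_ae_eq⟩

end Completeness

/-! ### Hölder bounds for pairings -/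

section Pairing

variable {α E : Type*} [MeasurableSpace α] {μ : Measure α}

theorem lintegral_enorm_mul_enorm_le {F : Type*} [NormedAddCommGroup E] [NormedAddCommGroup F]
    {p q : ℝ≥0∞} [ENNReal.HolderConjugate p q] {f : α → E} {g : α → F}
    (hf : AEStronglyMeasurable f μ) (hg : AEStronglyMeasurable g μ) :
    ∫⁻ x, ‖f x‖ₑ * ‖g x‖ₑ ∂μ ≤ eLpNorm f p μ * eLpNorm g q μ := by
  have h := eLpNorm_smul_le_mul_eLpNorm (p := p) (q := q) (r := 1) hg.norm hf.norm
  rw [eLpNorm_norm, eLpNorm_norm, eLpNorm_one_eq_lintegral_enorm] at h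
  simpa using h

variable [NormedAddCommGroup E] [InnerProductSpace ℝ E]

theorem MeasureTheory.MemLp.integrable_inner_two {V W : α → E} (hV : MemLp V 2 μ)
    (hW : MemLp W 2 μ) : Integrable (fun x => inner ℝ (V x) (W x)) μ := by
  refine Integrable.mono' (g := fun x => ‖V x‖ * ‖W x‖) (hV.norm.integrable_mul hW.norm)
    (hV.1.inner hW.1) (Eventually.of_forall fun x => norm_inner_le_norm _ _)

theorem enorm_integral_inner_le {V W : α → E} (hV : AEStronglyMeasurable V μ)
    (hW : AEStronglyMeasurable W μ) :
    ‖∫ x, inner ℝ (V x) (W x) ∂μ‖ₑ ≤ eLpNorm V 2 μ * eLpNorm W 2 μ := by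
  refine (enorm_integral_le_lintegral_enorm _).trans
    (le_trans (lintegral_mono fun x => ?_) (lintegral_enorm_mul_enorm_le hV hW))
  rw [← ofReal_norm, ← ofReal_norm, ← ofReal_norm, ← ENNReal.ofReal_mul (norm_nonneg _)]
  exact ENNReal.ofReal_le_ofReal (norm_inner_le_norm _ _)

end Pairing

/-! ### From the two half spaces to the whole space -/

section Transmission

variable {n : ℕ} [NeZero n]

theorem volume_hyperplane_eq_zero : volume {x : Rn n | x 0 = 0} = 0 := by
  have h := Measure.addHaar_submodule (volume : Measure (Rn n))
    (LinearMap.ker (EuclideanSpace.proj (𝕜 := ℝ) (0 : Fin n)).toLinearMap) ?_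
  · refine measure_mono_null (fun x hx => ?_) h
    simpa using hx
  · intro h
    have : EuclideanSpace.single (0 : Fin n) (1 : ℝ)
        ∈ LinearMap.ker (EuclideanSpace.proj (𝕜 := ℝ) (0 : Fin n)).toLinearMap := by
      rw [h]; trivial
    simp at this

/-- With the same test function as extension on both sides, equality of the traces says that the
integrals of `bη + V·∇η` over the half spaces sum to zero. The interface is a null set. -/
theorem TransmissionCondition.integral_inner_gradient {V : Rn n → Rn n} {b : Rn n → ℝ}
    (h : TransmissionCondition V b) (hV : MemLp V 2 volume) (hb : MemLp b 2 volume)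
    {η : Rn n → ℝ} (hη : IsTestFunction η) :
    ∫ x, inner ℝ (V x) (gradient η x) = -∫ x, b x * η x := by
  have i1 : Integrable fun x => inner ℝ (V x) (gradient η x) :=
    hV.integrable_inner_two (hη.memLp_gradient 2)
  have i2 : Integrable fun x => b x * η x := hb.integrable_mul (hη.memLp 2)
  have i := i2.add i1
  have h0 := h η η hη hη fun _ _ => rfl
  have mpos : MeasurableSet (halfPos n) :=
    (isOpen_lt continuous_const (EuclideanSpace.proj (𝕜 := ℝ) (0 : Fin n)).continuous).measurableSet
  have key : ∫ x in (halfPos n)ᶜ, (b x * η x + inner ℝ (V x) (gradient η x))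
      = ∫ x in halfNeg n, (b x * η x + inner ℝ (V x) (gradient η x)) := by
    refine setIntegral_congr_set ?_
    have : ∀ᵐ x : Rn n, x 0 ≠ 0 := by
      rw [ae_iff]
      simpa using volume_hyperplane_eq_zero (n := n)
    filter_upwards [this] with x hx
    refine propext ⟨fun h => ?_, fun h => ?_⟩
    · exact lt_of_le_of_ne (not_lt.1 h) hx
    · exact not_lt.2 (le_of_lt h)
  have h1 := integral_add_compl mpos i
  simp only [Pi.add_apply] at h1
  rw [key] at h1
  unfold tracePos traceNeg at h0
  rw [integral_add i2 i1] at h1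
  linarith

end Transmission

/-! ### Logarithmic growth of averages in the plane -/

section Planar

variable {u : Rn 2 → ℝ}

/-- In the plane the general bound is scale invariant: `πρ⁴ / (π²r²s²) ≤ 81/π ≤ 81` when `ρ ≤ 3r`
and `ρ ≤ 3s`, whence the factor `9`. -/
theorem IsTestFunction.enorm_average_sub_average_le_of_comparable (hu : IsTestFunction u)
    {x y : Rn 2} {r s ρ : ℝ} (hr : 0 < r) (hs : 0 < s) (h : r + s + dist x y ≤ ρ)
    (hρr : ρ ≤ 3 * r) (hρs : ρ ≤ 3 * s) :
    ‖(⨍ z in Metric.ball x r, u z) - ⨍ z in Metric.ball y s, u z‖ₑ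
      ≤ 9 * eLpNorm (gradient u) 2 volume := by
  have hρ : 0 < ρ := by linarith [dist_nonneg (x := x) (y := y)]
  have h1 := hu.sq_enorm_average_sub_average_le h
  simp only [EuclideanSpace.volume_ball_fin_two] at h1
  rw [← eLpNorm_two_sq] at h1
  set a := ‖(⨍ z in Metric.ball x r, u z) - ⨍ z in Metric.ball y s, u z‖ₑ
  set D := eLpNorm (gradient u) 2 volume
  have hpi : (1 : ℝ≥0∞) ≤ ENNReal.ofReal Real.pi := by
    rw [ENNReal.one_le_ofReal]
    linarith [Real.pi_gt_three]
  have hpit : ENNReal.ofReal Real.pi ≠ ⊤ := ENNReal.ofReal_ne_top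
  set P := ENNReal.ofReal Real.pi
  set r' := ENNReal.ofReal r with hr'
  set s' := ENNReal.ofReal s with hs'
  have hr0 : r' ≠ 0 := by simpa [hr'] using hr
  have hs0 : s' ≠ 0 := by simpa [hs'] using hs
  have hrt : r' ≠ ⊤ := ENNReal.ofReal_ne_top
  have hst : s' ≠ ⊤ := ENNReal.ofReal_ne_top
  have e1 : ENNReal.ofReal ρ ≤ 3 * r' := by
    rw [hr', show (3 : ℝ≥0∞) = ENNReal.ofReal 3 by simp, ← ENNReal.ofReal_mul (by norm_num)]
    exact ENNReal.ofReal_le_ofReal hρr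
  have e2 : ENNReal.ofReal ρ ≤ 3 * s' := by
    rw [hs', show (3 : ℝ≥0∞) = ENNReal.ofReal 3 by simp, ← ENNReal.ofReal_mul (by norm_num)]
    exact ENNReal.ofReal_le_ofReal hρs
  rw [← ENNReal.pow_le_pow_left_iff two_ne_zero]
  have hc0 : r' ^ 2 * P * (s' ^ 2 * P) ≠ 0 := by
    have : P ≠ 0 := (zero_lt_one.trans_le hpi).ne'
    positivity
  have hct : r' ^ 2 * P * (s' ^ 2 * P) ≠ ⊤ := by finiteness
  rw [← ENNReal.mul_le_mul_iff_left hc0 hct]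
  refine h1.trans ?_
  calc _ ≤ (3 * r') ^ 2 * P * (3 * s') ^ 2 * D ^ 2 := by gcongr
    _ = (9 * D) ^ 2 * (r' ^ 2 * (s' ^ 2 * P)) * 1 := by ring
    _ ≤ (9 * D) ^ 2 * (r' ^ 2 * (s' ^ 2 * P)) * P := by gcongr
    _ = _ := by ring

/-- Each doubling of the radius costs the same amount, whatever the scale; this is the source of the
logarithm. -/
theorem IsTestFunction.enorm_average_one_sub_average_two_pow_le (hu : IsTestFunction u)
    (x : Rn 2) (k : ℕ) :
    ‖(⨍ z in Metric.ball x 1, u z) - ⨍ z in Metric.ball x (2 ^ k), u z‖ₑ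
      ≤ k * (9 * eLpNorm (gradient u) 2 volume) := by
  induction k with
  | zero => simp
  | succ k ih =>
    have h2 : (0 : ℝ) < 2 ^ k := by positivity
    have h := hu.enorm_average_sub_average_le_of_comparable (x := x) (y := x) (r := 2 ^ k)
      (s := 2 ^ (k + 1)) (ρ := 3 * 2 ^ k) h2 (by positivity) (by rw [dist_self, pow_succ]; linarith)
      le_rfl (by rw [pow_succ]; linarith)
    rw [← edist_eq_enorm_sub] at ih h ⊢
    refine (edist_triangle _ _ _).trans ((add_le_add ih h).trans (le_of_eq ?_))
    push_cast
    ring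

/-- Averages over unit balls grow at most logarithmically. -/
theorem IsTestFunction.enorm_average_sub_average_zero_le (hu : IsTestFunction u) (x : Rn 2) :
    ‖(⨍ z in Metric.ball x 1, u z) - ⨍ z in Metric.ball (0 : Rn 2) 1, u z‖ₑ
      ≤ 90 * ENNReal.ofReal (Real.log (2 + ‖x‖)) * eLpNorm (gradient u) 2 volume := by
  set L := Real.log (2 + ‖x‖) with hL
  have hlog2 : (1 : ℝ) / 2 ≤ Real.log 2 := by linarith [Real.log_two_gt_d9]
  have hL2 : Real.log 2 ≤ L := Real.log_le_log two_pos (by linarith [norm_nonneg x])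
  have hlog2' : 0 < Real.log 2 := by linarith
  -- This `k` gives `2^k ≥ 2 + |x|`. The radius is doubled `k` times around `x`, the two large balls
  -- are compared once, and the radius is halved `k` times around `0`: `2k + 1` steps of cost `9`.
  set k := ⌈L / Real.log 2⌉₊ with hk
  have hk1 : L / Real.log 2 ≤ k := Nat.le_ceil _
  have hk2 : (k : ℝ) < L / Real.log 2 + 1 :=
    Nat.ceil_lt_add_one (div_nonneg (hlog2'.le.trans hL2) hlog2'.le)
  have hxk : ‖x‖ ≤ 2 ^ k := by
    have h1 : L ≤ k * Real.log 2 := (div_le_iff₀ hlog2').1 hk1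
    have h2 : 2 + ‖x‖ ≤ 2 ^ k := by
      rw [← Real.log_le_log_iff (by positivity) (by positivity), Real.log_pow]
      exact h1
    linarith
  -- From `log 2 ≥ 1/2` one gets `2k + 1 ≤ 4L + 3`, and `3 ≤ 6L` because `L ≥ log 2 ≥ 1/2`.
  have hkL : 2 * (k : ℝ) + 1 ≤ 10 * L := by
    have h3 : L / Real.log 2 ≤ 2 * L := by
      rw [div_le_iff₀ hlog2']
      nlinarith
    linarith
  have h1 := hu.enorm_average_one_sub_average_two_pow_le x k
  have h2 := hu.enorm_average_one_sub_average_two_pow_le 0 k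
  have h2k : (0 : ℝ) < 2 ^ k := by positivity
  have h3 := hu.enorm_average_sub_average_le_of_comparable (x := x) (y := 0) (r := 2 ^ k)
      (s := 2 ^ k) (ρ := 3 * 2 ^ k) h2k h2k (by rw [dist_zero_right]; linarith) le_rfl le_rfl
  rw [← edist_eq_enorm_sub] at h1 h2 h3 ⊢
  rw [edist_comm] at h2
  refine (edist_triangle4 _ _ _ _).trans ((add_le_add (add_le_add h1 h3) h2).trans ?_)
  have e : (2 * (k : ℝ≥0∞) + 1) ≤ 10 * ENNReal.ofReal L := by
    have := ENNReal.ofReal_le_ofReal hkL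
    rw [ENNReal.ofReal_mul (by norm_num), ENNReal.ofReal_add (by positivity) (by norm_num),
      ENNReal.ofReal_mul (by norm_num)] at this
    simpa using this
  calc _ = (2 * (k : ℝ≥0∞) + 1) * (9 * eLpNorm (gradient u) 2 volume) := by ring
    _ ≤ (10 * ENNReal.ofReal L) * (9 * eLpNorm (gradient u) 2 volume) := by gcongr
    _ = 90 * ENNReal.ofReal L * eLpNorm (gradient u) 2 volume := by ring

/-- The average over the unit ball around `x` is inserted. The local oscillation is in `L²` and
pairs with `b ∈ L²`; the drift of the averages is logarithmic and pairs with the weighted `L¹` norm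
of `b`. -/
theorem IsTestFunction.lintegral_enorm_mul_sub_average_le (hu : IsTestFunction u) {b : Rn 2 → ℝ}
    (hb : AEStronglyMeasurable b volume) :
    ∫⁻ x, ‖b x‖ₑ * ‖u x - ⨍ z in Metric.ball (0 : Rn 2) 1, u z‖ₑ
      ≤ 90 * (eLpNorm b 2 volume + ∫⁻ x, ENNReal.ofReal (Real.log (2 + ‖x‖)) * ‖b x‖ₑ) *
        eLpNorm (gradient u) 2 volume := by
  set D := eLpNorm (gradient u) 2 volume with hD
  set v := volume (Metric.ball (0 : Rn 2) 1) with hv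
  have hv0 : v ≠ 0 := (Metric.measure_ball_pos volume (0 : Rn 2) one_pos).ne'
  have hvt : v ≠ ⊤ := measure_ball_lt_top.ne
  -- The root mean square of `u(x+h) - u(x)` over `|h| < 1`. It dominates the local oscillation, and
  -- its `L²` norm is at most `‖∇u‖₂` since each translation estimate has `|h|² ≤ 1`.
  set g : Rn 2 → ℝ≥0∞ := fun x =>
    (v⁻¹ * ∫⁻ h in Metric.ball (0 : Rn 2) 1, ‖u (x + h) - u x‖ₑ ^ 2) ^ (1 / 2 : ℝ) with hg
  have hc : Continuous fun z : Rn 2 × Rn 2 => ‖u (z.1 + z.2) - u z.1‖ₑ :=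
    ((hu.continuous.comp (by fun_prop)).sub (hu.continuous.comp continuous_fst)).enorm
  have hm : Measurable fun z : Rn 2 × Rn 2 => ‖u (z.1 + z.2) - u z.1‖ₑ ^ 2 :=
    hc.measurable.pow_const 2
  have gm : Measurable g := ((hm.lintegral_prod_right').const_mul _).pow_const _
  have gsq : ∀ x, g x ^ (2 : ℝ)
      = v⁻¹ * ∫⁻ h in Metric.ball (0 : Rn 2) 1, ‖u (x + h) - u x‖ₑ ^ 2 := fun x => by
    rw [hg, ← ENNReal.rpow_mul]
    norm_num
  have local_le : ∀ x, ‖u x - ⨍ z in Metric.ball x 1, u z‖ₑ ≤ g x := by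
    intro x
    have h1 := sq_enorm_sub_average_le (hu.integrable.restrict (s := Metric.ball x 1)) (u x)
    have h2 : ∫⁻ y in Metric.ball x 1, ‖u x - u y‖ₑ ^ 2
        = ∫⁻ h in Metric.ball (0 : Rn 2) 1, ‖u (x + h) - u x‖ₑ ^ 2 := by
      rw [← lintegral_indicator Metric.isOpen_ball.measurableSet,
        ← lintegral_indicator Metric.isOpen_ball.measurableSet,
        ← lintegral_add_left_eq_self _ x]
      refine lintegral_congr fun y => ?_
      simp [Set.indicator, enorm_sub_rev]
    rw [h2, Measure.restrict_apply_univ, Measure.addHaar_ball_center, ← hv,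
      ← ENNReal.le_div_iff_mul_le (Or.inl hv0) (Or.inl hvt)] at h1
    rw [← ENNReal.rpow_le_rpow_iff (z := 2) two_pos, gsq]
    rw [mul_comm, ← div_eq_mul_inv]
    simpa using h1
  have g_norm : (∫⁻ x, g x ^ (2 : ℝ)) ^ (1 / 2 : ℝ) ≤ D := by
    have h1 : ∫⁻ x, g x ^ (2 : ℝ) ≤ D ^ (2 : ℝ) := by
      simp only [gsq]
      rw [lintegral_const_mul' _ _ (ENNReal.inv_ne_top.2 hv0), lintegral_lintegral_swap
        hm.aemeasurable]
      have h2 : ∫⁻ h in Metric.ball (0 : Rn 2) 1, ∫⁻ x, ‖u (x + h) - u x‖ₑ ^ 2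
          ≤ ∫⁻ h in Metric.ball (0 : Rn 2) 1, D ^ 2 := by
        refine setLIntegral_mono' Metric.isOpen_ball.measurableSet fun h hh => ?_
        refine (hu.lintegral_sq_translate_sub_le h).trans ?_
        rw [← eLpNorm_two_sq]
        refine mul_le_of_le_one_left' ?_
        refine pow_le_one' ?_ 2
        rw [← ofReal_norm, ENNReal.ofReal_le_one]
        simpa using (Metric.mem_ball.1 hh).le
      rw [setLIntegral_const] at h2
      calc _ ≤ v⁻¹ * (D ^ 2 * v) := mul_le_mul_right h2 _
        _ = D ^ 2 * (v⁻¹ * v) := by ring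
        _ = D ^ (2 : ℝ) := by rw [ENNReal.inv_mul_cancel hv0 hvt]; simp
    calc _ ≤ (D ^ (2 : ℝ)) ^ (1 / 2 : ℝ) := ENNReal.rpow_le_rpow h1 (by norm_num)
      _ = D := by rw [← ENNReal.rpow_mul]; norm_num
  have split : ∀ x, ‖b x‖ₑ * ‖u x - ⨍ z in Metric.ball (0 : Rn 2) 1, u z‖ₑ
      ≤ ‖b x‖ₑ * g x + 90 * D * (ENNReal.ofReal (Real.log (2 + ‖x‖)) * ‖b x‖ₑ) := by
    intro x
    have h1 := hu.enorm_average_sub_average_zero_le x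
    have h2 := local_le x
    rw [← edist_eq_enorm_sub] at h1 h2 ⊢
    calc _ ≤ ‖b x‖ₑ * (g x + 90 * ENNReal.ofReal (Real.log (2 + ‖x‖)) * D) := by
          gcongr
          exact (edist_triangle _ _ _).trans (add_le_add h2 h1)
      _ = _ := by ring
  have hD_top : D ≠ ⊤ := (hu.memLp_gradient 2).2.ne
  refine (lintegral_mono split).trans ?_
  have hbg : AEMeasurable (fun x => ‖b x‖ₑ * g x) volume := hb.enorm.mul gm.aemeasurable
  rw [lintegral_add_left' hbg,
    lintegral_const_mul' _ _ (by finiteness)]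
  have h3 : ∫⁻ x, ‖b x‖ₑ * g x ≤ eLpNorm b 2 volume * D := by
    have := ENNReal.lintegral_mul_le_Lp_mul_Lq volume Real.HolderConjugate.two_two hb.enorm
      gm.aemeasurable
    refine this.trans (mul_le_mul' (le_of_eq ?_) g_norm)
    rw [eLpNorm_eq_lintegral_rpow_enorm_toReal (by norm_num) (by norm_num)]
    simp
  refine (add_le_add_left h3 _).trans ?_
  calc _ = 1 * (eLpNorm b 2 volume * D)
        + 90 * D * ∫⁻ x, ENNReal.ofReal (Real.log (2 + ‖x‖)) * ‖b x‖ₑ := by rw [one_mul]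
    _ ≤ 90 * (eLpNorm b 2 volume * D)
        + 90 * D * ∫⁻ x, ENNReal.ofReal (Real.log (2 + ‖x‖)) * ‖b x‖ₑ := by
        gcongr
        norm_num
    _ = _ := by ring

end Planar

/-! ### Vanishing mean of a planar divergence -/

section Cutoff

/-- Cutoff functions `χ_k` with `χ_k → 1` whose gradients are bounded in `L²(ℝ²)` and are supported
in `{|x| ≥ k+1}`. -/
theorem exists_planar_cutoffs : ∃ (χ : ℕ → Rn 2 → ℝ) (C : ℝ≥0),
    (∀ k, IsTestFunction (χ k)) ∧ (∀ k x, ‖χ k x‖ ≤ 1) ∧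
    (∀ x, Tendsto (fun k => χ k x) atTop (𝓝 1)) ∧
    (∀ k, eLpNorm (gradient (χ k)) 2 volume ≤ C) ∧
    ∀ (k : ℕ) x, ‖x‖ < k + 1 → gradient (χ k) x = 0 := by
  let f : ContDiffBump (0 : Rn 2) := ⟨1, 2, one_pos, one_lt_two⟩
  have hf : IsTestFunction f := ⟨f.contDiff, f.hasCompactSupport⟩
  set t : ℕ → ℝ := fun k => (k + 1 : ℝ)⁻¹ with ht
  have t_pos : ∀ k, 0 < t k := fun k => by simp only [ht]; positivity
  obtain ⟨M, hM⟩ := hf.hasCompactSupport_gradient.exists_bound_of_continuous hf.continuous_gradient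
  set χ : ℕ → Rn 2 → ℝ := fun k x => f (t k • x) with hχ
  have hgrad : ∀ k x, gradient (χ k) x = t k • gradient f (t k • x) := by
    intro k x
    have h1 : HasFDerivAt (fun y : Rn 2 => t k • y) (t k • ContinuousLinearMap.id ℝ (Rn 2)) x :=
      (hasFDerivAt_id x).const_smul (t k)
    have h2 := (hf.differentiable (t k • x)).hasFDerivAt.comp x h1
    have h3 : fderiv ℝ (χ k) x = t k • fderiv ℝ f (t k • x) := by
      change fderiv ℝ (f ∘ fun y : Rn 2 => t k • y) x = _
      rw [h2.fderiv]
      ext v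
      simp
    simp [gradient, h3]
  have hχtest : ∀ k, IsTestFunction (χ k) := fun k =>
    ⟨hf.1.comp (contDiff_const_smul (t k)),
      hf.2.comp_homeomorph (Homeomorph.smulOfNeZero (t k) (t_pos k).ne')⟩
  have hnorm : ∀ (k : ℕ) (x : Rn 2), ‖t k • x‖ = ‖x‖ / (k + 1) := fun k x => by
    rw [norm_smul, Real.norm_of_nonneg (t_pos k).le, ht, inv_mul_eq_div]
  -- The gradient is at most `M/(k+1)` and vanishes outside the ball of radius `3(k+1)`, of area
  -- `9π(k+1)²`. The scale cancels and the `L²` norm is at most `3M√π`.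
  refine ⟨χ, (M * 3).toNNReal * (NNReal.sqrt NNReal.pi), hχtest, fun k x => ?_, fun x => ?_,
    fun k => ?_, fun k x hx => ?_⟩
  · rw [Real.norm_of_nonneg f.nonneg]
    exact f.le_one
  · have h1 : Tendsto (fun k : ℕ => t k • x) atTop (𝓝 0) := by
      have : Tendsto t atTop (𝓝 0) := by
        simpa [ht] using tendsto_one_div_add_atTop_nhds_zero_nat (𝕜 := ℝ)
      simpa using this.smul_const x
    have h2 := (f.continuous.tendsto 0).comp h1
    rwa [f.one_of_mem_closedBall (by simp [f])] at h2
  · have hk : (0 : ℝ) < k + 1 := by positivity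
    have hM0 : 0 ≤ M := (norm_nonneg _).trans (hM 0)
    have bound : ∀ x, ‖gradient (χ k) x‖ₑ ^ 2
        ≤ (Metric.ball (0 : Rn 2) (3 * (k + 1))).indicator
          (fun _ => ENNReal.ofReal (M / (k + 1)) ^ 2) x := by
      intro x
      by_cases hx : x ∈ Metric.ball (0 : Rn 2) (3 * (k + 1))
      · rw [Set.indicator_of_mem hx, hgrad, ← ofReal_norm, norm_smul,
          Real.norm_of_nonneg (t_pos k).le]
        gcongr
        rw [ht, inv_mul_eq_div]
        gcongr
        exact hM _
      · rw [Set.indicator_of_notMem hx, hgrad]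
        have hx' : 3 * ((k : ℝ) + 1) ≤ ‖x‖ := by simpa using hx
        have : t k • x ∉ tsupport f := by
          rw [f.tsupport_eq, Metric.mem_closedBall, dist_zero_right, hnorm, not_le,
            lt_div_iff₀ hk]
          change 2 * ((k : ℝ) + 1) < _
          linarith
        have h0 : fderiv ℝ f (t k • x) = 0 :=
          image_eq_zero_of_notMem_tsupport fun h => this (tsupport_fderiv_subset ℝ h)
        simp [gradient, h0]
    rw [← ENNReal.pow_le_pow_left_iff two_ne_zero, eLpNorm_two_sq]
    refine (lintegral_mono bound).trans ?_
    rw [lintegral_indicator Metric.isOpen_ball.measurableSet, setLIntegral_const,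
      EuclideanSpace.volume_ball_fin_two, ENNReal.coe_mul, mul_pow, ← ENNReal.coe_pow,
      ← ENNReal.coe_pow, NNReal.sq_sqrt, ENNReal.coe_pow, ← mul_assoc, ← mul_pow,
      ← ENNReal.ofReal_mul (by positivity)]
    refine mul_le_mul' (pow_le_pow_left' ?_ 2) ?_
    · exact ENNReal.ofReal_le_ofReal (le_of_eq (by field_simp))
    · rw [← NNReal.coe_real_pi, ENNReal.ofReal_coe_nnreal]
  · rw [hgrad]
    have h1 : t k • x ∈ Metric.ball (0 : Rn 2) f.rIn := by
      rw [Metric.mem_ball, dist_zero_right, hnorm, div_lt_iff₀ (by positivity)]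
      change ‖x‖ < 1 * _
      linarith
    have h2 := f.eventuallyEq_one_of_mem_ball h1
    have h3 : fderiv ℝ f (t k • x) = 0 := by
      rw [h2.fderiv_eq]
      exact fderiv_const_apply 1
    simp [gradient, h3]

/-- Testing with the cutoffs, `∫ bχ_k` tends to `∫ b`. The other side sees `V` only on `{|x| ≥
k+1}`, where its `L²` norm tends to zero, against gradients bounded in `L²`. -/
theorem integral_eq_zero_of_planar_divergence {V : Rn 2 → Rn 2} {b : Rn 2 → ℝ}
    (hV : MemLp V 2 volume) (hb : Integrable b)
    (h : ∀ η, IsTestFunction η → ∫ x, inner ℝ (V x) (gradient η x) = -∫ x, b x * η x) :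
    ∫ x, b x = 0 := by
  obtain ⟨χ, C, hχ, hχ1, hlim, hC, h0⟩ := exists_planar_cutoffs
  have t1 : Tendsto (fun k => ∫ x, b x * χ k x) atTop (𝓝 (∫ x, b x)) := by
    refine tendsto_integral_of_dominated_convergence (fun x => ‖b x‖)
      (fun k => hb.1.mul (hχ k).continuous.aestronglyMeasurable) hb.norm
      (fun k => Eventually.of_forall fun x => ?_) (Eventually.of_forall fun x => ?_)
    · rw [norm_mul]
      exact mul_le_of_le_one_right (norm_nonneg _) (hχ1 k x)
    · simpa using (hlim x).const_mul (b x)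
  have t2 : Tendsto (fun k => ∫ x, inner ℝ (V x) (gradient (χ k) x)) atTop (𝓝 0) := by
    set S : ℕ → Set (Rn 2) := fun k => {x | (k : ℝ) + 1 ≤ ‖x‖} with hS
    have mS : ∀ k, MeasurableSet (S k) := fun k =>
      (isClosed_le continuous_const continuous_norm).measurableSet
    have tail : Tendsto (fun k => eLpNorm ((S k).indicator V) 2 volume ^ 2) atTop (𝓝 0) := by
      simp only [eLpNorm_two_sq]
      have := tendsto_lintegral_of_dominated_convergence' (μ := (volume : Measure (Rn 2)))
        (F := fun k x => ‖(S k).indicator V x‖ₑ ^ 2) (f := fun _ => 0) (fun x => ‖V x‖ₑ ^ 2)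
        (fun k => (hV.1.indicator (mS k)).enorm.pow_const 2)
        (fun k => Eventually.of_forall fun x => ?_) ?_ (Eventually.of_forall fun x => ?_)
      · simpa using this
      · exact pow_le_pow_left' (enorm_indicator_le_enorm_self _ _) 2
      · rw [← eLpNorm_two_sq]
        exact ENNReal.pow_ne_top hV.2.ne
      · refine tendsto_const_nhds.congr' ?_
        obtain ⟨N, hN⟩ := exists_nat_gt ‖x‖
        filter_upwards [eventually_ge_atTop N] with k hk
        have : x ∉ S k := by
          simp only [hS, Set.mem_ofPred_eq, not_le]
          have : (N : ℝ) ≤ k := by exact_mod_cast hk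
          linarith
        simp [this]
    have tail' : Tendsto (fun k => eLpNorm ((S k).indicator V) 2 volume * C) atTop (𝓝 0) := by
      have h1 := (ENNReal.continuous_rpow_const (y := 1 / 2)).tendsto 0 |>.comp tail
      have h2 : ((fun a : ℝ≥0∞ => a ^ (1 / 2 : ℝ)) ∘
          fun k => eLpNorm ((S k).indicator V) 2 volume ^ 2)
          = fun k => eLpNorm ((S k).indicator V) 2 volume := by
        funext k
        simp only [Function.comp]
        rw [← ENNReal.rpow_natCast, ← ENNReal.rpow_mul]
        norm_num
      rw [h2, ENNReal.zero_rpow_of_pos (by norm_num)] at h1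
      simpa using ENNReal.Tendsto.mul_const (b := (C : ℝ≥0∞)) h1 (Or.inr ENNReal.coe_ne_top)
    refine (tendsto_zero_iff_enorm_tendsto_zero).2 ?_
    refine tendsto_of_tendsto_of_tendsto_of_le_of_le tendsto_const_nhds tail' (fun _ => zero_le) ?_
    intro k
    have e : ∀ x, inner ℝ (V x) (gradient (χ k) x)
        = inner ℝ ((S k).indicator V x) (gradient (χ k) x) := by
      intro x
      by_cases hx : x ∈ S k
      · simp [hx]
      · rw [h0 k x (not_le.1 hx)]
        simp
    simp only [e]
    exact (enorm_integral_inner_le (hV.1.indicator (mS k))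
      (hχ k).continuous_gradient.aestronglyMeasurable).trans (mul_le_mul_right (hC k) _)
  simp only [h _ (hχ _)] at t2
  have := tendsto_nhds_unique t1.neg t2
  simpa using this

end Cutoff

/-! ### Bounding the linear functional by the divergence -/

section FunctionalBound

/-- The weight is at least `log 2`, so `b` is integrable and has mean zero. The test function may
therefore be replaced by its difference from its average over the unit ball. -/
theorem planar_enorm_integral_inner_gradient_le {V : Rn 2 → Rn 2} {b : Rn 2 → ℝ}
    (hV : MemLp V 2 volume) (hb : MemLp b 2 volume) (hb' : tripleNorm b < ⊤)
    (h : ∀ η, IsTestFunction η → ∫ x, inner ℝ (V x) (gradient η x) = -∫ x, b x * η x)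
    {η : Rn 2 → ℝ} (hη : IsTestFunction η) :
    ‖∫ x, inner ℝ (V x) (gradient η x)‖ₑ
      ≤ 90 * (eLpNorm b 2 volume + tripleNorm b) * eLpNorm (gradient η) 2 volume := by
  rw [tripleNorm, if_pos rfl] at hb' ⊢
  have hi : Integrable b := by
    refine ⟨hb.1, ?_⟩
    have hlog : ENNReal.ofReal (Real.log 2) ≠ 0 := by simp [Real.log_pos]
    have h1 : ENNReal.ofReal (Real.log 2) * ∫⁻ x, ‖b x‖ₑ
        ≤ ∫⁻ x, ENNReal.ofReal (Real.log (2 + ‖x‖)) * ‖b x‖ₑ := by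
      rw [← lintegral_const_mul' _ _ ENNReal.ofReal_ne_top]
      refine lintegral_mono fun x => ?_
      gcongr
      linarith [norm_nonneg x]
    exact lt_of_mul_lt_mul_left' (a := ENNReal.ofReal (Real.log 2))
      ((h1.trans_lt hb').trans_eq (ENNReal.mul_top hlog).symm)
  have hzero := integral_eq_zero_of_planar_divergence hV hi h
  set c := ⨍ z in Metric.ball (0 : Rn 2) 1, η z
  have e : ∫ x, b x * η x = ∫ x, b x * (η x - c) := by
    simp only [mul_sub]
    have i : Integrable fun x => b x * η x := hb.integrable_mul (hη.memLp 2)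
    rw [integral_sub i (hi.mul_const c), integral_mul_const, hzero]
    simp
  rw [h η hη, enorm_neg, e]
  refine (enorm_integral_le_lintegral_enorm _).trans ?_
  simp only [enorm_mul]
  exact hη.lintegral_enorm_mul_sub_average_le hb.1

/-- Hölder with the conjugate exponents `2n/(n+2)` and `2n/(n-2)`, then the Sobolev inequality for
the second factor. -/
theorem exists_enorm_integral_mul_le {n : ℕ} (hn : 3 ≤ n) : ∃ C : ℝ≥0, ∀ b η : Rn n → ℝ,
    AEStronglyMeasurable b volume → IsTestFunction η →
    ‖∫ x, b x * η x‖ₑ ≤ C * tripleNorm b * eLpNorm (gradient η) 2 volume := by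
  have hn' : (3 : ℝ) ≤ n := by exact_mod_cast hn
  let q : ℝ≥0 := ⟨2 * n / (n - 2), div_nonneg (by positivity) (by linarith)⟩
  have hq : (q : ℝ) = 2 * n / (n - 2) := rfl
  have hqinv : ((q : ℝ≥0) : ℝ)⁻¹ = ((2 : ℝ≥0) : ℝ)⁻¹ - (Module.finrank ℝ (Rn n) : ℝ)⁻¹ := by
    rw [hq, finrank_euclideanSpace_fin]
    have : (n : ℝ) - 2 ≠ 0 := by linarith
    push_cast
    field_simp
  refine ⟨SNormLESNormFDerivOfEqConst ℝ (volume : Measure (Rn n)) 2, fun b η hb hη => ?_⟩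
  have h1 := eLpNorm_le_eLpNorm_fderiv_of_eq (volume : Measure (Rn n)) (hη.1.of_le (by simp)) hη.2
    (p := 2) (p' := q) (by norm_num) (by rw [finrank_euclideanSpace_fin]; omega) hqinv
  have e : eLpNorm (fderiv ℝ η) (2 : ℝ≥0) volume = eLpNorm (gradient η) 2 volume :=
    eLpNorm_congr_norm_ae (Eventually.of_forall fun x => (norm_gradient_eq_norm_fderiv η x).symm)
  rw [e] at h1
  have hconj : ENNReal.HolderConjugate (ENNReal.ofReal (2 * n / (n + 2))) q := by
    rw [ENNReal.holderConjugate_iff]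
    have h2 : (q : ℝ≥0∞) = ENNReal.ofReal (2 * n / (n - 2)) := by
      rw [← hq, ENNReal.ofReal_coe_nnreal]
    have h3 : (0 : ℝ) < n - 2 := by linarith
    rw [h2, ← ENNReal.ofReal_inv_of_pos (by positivity), ← ENNReal.ofReal_inv_of_pos (by positivity),
      ← ENNReal.ofReal_add (by positivity) (by positivity), ← ENNReal.ofReal_one]
    congr 1
    field_simp
    ring
  rw [tripleNorm, if_neg (by omega)]
  refine (enorm_integral_le_lintegral_enorm _).trans ?_
  simp only [enorm_mul]
  refine (lintegral_enorm_mul_enorm_le (p := ENNReal.ofReal (2 * n / (n + 2)))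
    (q := (q : ℝ≥0∞)) hb (hη.memLp 1).1).trans ?_
  refine (mul_le_mul_right h1 _).trans (le_of_eq ?_)
  simp only [NNReal.coe_ofNat]
  ring

/-- Approximation by test functions costs `‖V‖₂ δ`, which disappears as `δ → 0`. Hence `V ∈ L²` is
needed, but its norm does not enter the bound. -/
theorem enorm_integral_inner_weakGradient_le {n : ℕ} {V : Rn n → Rn n} (hV : MemLp V 2 volume)
    {K : ℝ≥0∞} (hK : K ≠ ⊤)
    (h : ∀ η, IsTestFunction η →
      ‖∫ x, inner ℝ (V x) (gradient η x)‖ₑ ≤ K * eLpNorm (gradient η) 2 volume)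
    {ψ : Rn n → ℝ} (hψ : MemD0 2 ψ) :
    ‖∫ x, inner ℝ (V x) (weakGradient ψ x)‖ₑ ≤ K * eLpNorm (weakGradient ψ) 2 volume := by
  set D := eLpNorm (weakGradient ψ) 2 volume
  have hVt : eLpNorm V 2 volume ≠ ⊤ := hV.2.ne
  have key : ∀ δ : ℝ≥0∞, 0 < δ → ‖∫ x, inner ℝ (V x) (weakGradient ψ x)‖ₑ
      ≤ K * (D + δ) + eLpNorm V 2 volume * δ := by
    intro δ hδ
    obtain ⟨η, hη, hη'⟩ := hψ.approx δ hδ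
    have mg := hη.continuous_gradient.aestronglyMeasurable (μ := volume)
    have hd : MemLp (fun x => weakGradient ψ x - gradient η x) 2 volume :=
      hψ.memLp_grad.sub (hη.memLp_gradient 2)
    have e : ∫ x, inner ℝ (V x) (weakGradient ψ x) = (∫ x, inner ℝ (V x) (gradient η x))
        + ∫ x, inner ℝ (V x) (weakGradient ψ x - gradient η x) := by
      rw [← integral_add (hV.integrable_inner_two (hη.memLp_gradient 2))
        (hV.integrable_inner_two hd)]
      refine integral_congr_ae (Eventually.of_forall fun x => ?_)
      simp [inner_sub_right]
    have e2 : eLpNorm (gradient η) 2 volume ≤ D + δ := by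
      have e3 : gradient η = weakGradient ψ - (fun x => weakGradient ψ x - gradient η x) := by
        funext x
        simp
      rw [e3]
      exact (eLpNorm_sub_le hψ.memLp_grad.1 hd.1 (by norm_num)).trans (add_le_add_right hη' _)
    rw [e]
    refine (enorm_add_le _ _).trans (add_le_add ((h η hη).trans (mul_le_mul_right e2 _)) ?_)
    exact (enorm_integral_inner_le hV.1 hd.1).trans (mul_le_mul_right hη' _)
  have t : Tendsto (fun δ : ℝ≥0∞ => K * (D + δ) + eLpNorm V 2 volume * δ) (𝓝[>] 0)
      (𝓝 (K * (D + 0) + eLpNorm V 2 volume * 0)) := by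
    refine Tendsto.mono_left (Tendsto.add ?_ ?_) nhdsWithin_le_nhds
    · exact ENNReal.Tendsto.const_mul (tendsto_const_nhds.add tendsto_id) (Or.inr hK)
    · exact ENNReal.Tendsto.const_mul tendsto_id (Or.inr hVt)
  have := ge_of_tendsto t (eventually_mem_nhdsWithin.mono fun δ hδ => key δ hδ)
  simpa using this

/-- The functional `ψ ↦ ∫ V·∇ψ` is bounded on `D_0^{1,2}` in terms of the divergence of `V`
alone. -/
theorem exists_enorm_integral_inner_weakGradient_le (n : ℕ) [NeZero n] (hn : 2 ≤ n) :
    ∃ K : ℝ≥0, ∀ (V : Rn n → Rn n) (b : Rn n → ℝ), MemLp V 2 volume → MemLp b 2 volume →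
      tripleNorm b < ⊤ → TransmissionCondition V b → ∀ ψ, MemD0 2 ψ →
      ‖∫ x, inner ℝ (V x) (weakGradient ψ x)‖ₑ
        ≤ K * (eLpNorm b 2 volume + tripleNorm b) * eLpNorm (weakGradient ψ) 2 volume := by
  rcases hn.eq_or_lt with rfl | hn
  · refine ⟨90, fun V b hV hb hb' h ψ hψ => ?_⟩
    have hb2 := hb.2.ne
    refine enorm_integral_inner_weakGradient_le hV ?_ (fun η hη => ?_) hψ
    · exact ENNReal.mul_ne_top ENNReal.coe_ne_top (ENNReal.add_ne_top.2 ⟨hb2, hb'.ne⟩)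
    · simpa using planar_enorm_integral_inner_gradient_le hV hb hb'
        (fun η hη => h.integral_inner_gradient hV hb hη) hη
  · obtain ⟨C, hC⟩ := exists_enorm_integral_mul_le (n := n) hn
    refine ⟨C, fun V b hV hb hb' h ψ hψ => ?_⟩
    have hb2 := hb.2.ne
    refine enorm_integral_inner_weakGradient_le hV ?_ (fun η hη => ?_) hψ
    · exact ENNReal.mul_ne_top ENNReal.coe_ne_top (ENNReal.add_ne_top.2 ⟨hb2, hb'.ne⟩)
    · rw [h.integral_inner_gradient hV hb hη, enorm_neg]
      refine (hC b η hb.1 hη).trans ?_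
      gcongr
      exact le_add_self

end FunctionalBound

/-! ### Minimising sequences and uniform convexity -/

section Minimization

/-- A minimizing sequence that is Cauchy with respect to the modulus of uniform convexity `M` of
the coercive quantity `N`. -/
theorem exists_minimizing_seq {X : Type*} [Nonempty X] (mid : X → X → X) (E N : X → ℝ)
    (M : X → X → ℝ) (hE : ∀ x y, E (mid x y) ≤ (E x + E y) / 2)
    (hN : ∀ x y, N (mid x y) + M x y ≤ (N x + N y) / 2) (hN0 : ∀ x, 0 ≤ N x) {c : ℝ}
    (hc : 0 < c) (hEN : ∀ x, c * N x ≤ E x) :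
    ∃ (x : ℕ → X) (B : ℕ → ℝ), Tendsto B atTop (𝓝 0) ∧
      (∀ k y, E (x k) ≤ E y + 1 / ((k : ℝ) + 1)) ∧ ∀ j k, k ≤ j → M (x j) (x k) ≤ B k := by
  have hE0 : ∀ x, 0 ≤ E x := fun x => (mul_nonneg hc.le (hN0 x)).trans (hEN x)
  set m := ⨅ y, E y with hm
  have hbdd : BddBelow (Set.range E) := ⟨0, by rintro _ ⟨x, rfl⟩; exact hE0 x⟩
  have hmle : ∀ y, m ≤ E y := fun y => ciInf_le hbdd y
  -- These sets of near minimisers decrease and are closed under midpoints. The infima of `N` over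
  -- them increase, and coercivity bounds them.
  set S : ℕ → Set X := fun k => {x | E x ≤ m + 1 / ((k : ℝ) + 1)} with hS
  have hpos : ∀ k : ℕ, 0 < 1 / ((k : ℝ) + 1) := fun k => by positivity
  have hanti : ∀ {j k : ℕ}, k ≤ j → 1 / ((j : ℝ) + 1) ≤ 1 / ((k : ℝ) + 1) := fun h =>
    one_div_le_one_div_of_le (by positivity) (by exact_mod_cast Nat.succ_le_succ h)
  have hSne : ∀ k, (S k).Nonempty := by
    intro k
    obtain ⟨y, hy⟩ := exists_lt_of_ciInf_lt (lt_add_of_pos_right m (hpos k))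
    exact ⟨y, hy.le⟩
  have hSmono : ∀ {j k}, k ≤ j → S j ⊆ S k := fun h x hx =>
    (show E x ≤ _ from hx).trans (by linarith [hanti h])
  set s : ℕ → ℝ := fun k => sInf (N '' S k) with hs
  have hsb : ∀ k, BddBelow (N '' S k) := fun k => ⟨0, by rintro _ ⟨x, -, rfl⟩; exact hN0 x⟩
  have hsle : ∀ k x, x ∈ S k → s k ≤ N x := fun k x hx => csInf_le (hsb k) ⟨x, hx, rfl⟩
  have hsmono : Monotone s := fun k j h =>
    csInf_le_csInf (hsb k) ((hSne j).image N) (Set.image_mono (hSmono h))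
  have hsbdd : BddAbove (Set.range s) := by
    refine ⟨(m + 1) / c, ?_⟩
    rintro _ ⟨k, rfl⟩
    obtain ⟨x, hx⟩ := hSne k
    refine (hsle k x hx).trans ?_
    rw [le_div_iff₀ hc, mul_comm]
    refine (hEN x).trans ((show E x ≤ _ from hx).trans ?_)
    have := hanti (Nat.zero_le k)
    norm_num at this ⊢
    exact this
  have hslim := tendsto_atTop_ciSup hsmono hsbdd
  set L := ⨆ k, s k
  have hx : ∀ k, ∃ x ∈ S k, N x ≤ s k + 1 / ((k : ℝ) + 1) := by
    intro k
    obtain ⟨_, ⟨x, hx, rfl⟩, h⟩ := exists_lt_of_csInf_lt ((hSne k).image N)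
      (lt_add_of_pos_right (s k) (hpos k))
    exact ⟨x, hx, h.le⟩
  choose x hxS hxN using hx
  refine ⟨x, fun k => (L - s k) / 2 + 1 / ((k : ℝ) + 1), ?_, ?_, ?_⟩
  · have h1 := ((hslim.const_sub L).div_const 2).add
      (tendsto_one_div_add_atTop_nhds_zero_nat (𝕜 := ℝ))
    simpa using h1
  · intro k y
    exact (show E (x k) ≤ _ from hxS k).trans (by linarith [hmle y])
  · intro j k hjk
    have h1 : x j ∈ S k := hSmono hjk (hxS j)
    -- The midpoint competes in the infimum `s k`, so `s k + M` is at most the mean of two values of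
    -- `N` that are close to `s j` and `s k`. This leaves `(s j - s k)/2` plus the error.
    have h2 : mid (x j) (x k) ∈ S k := by
      refine (hE _ _).trans ?_
      have h3 : E (x j) ≤ m + 1 / ((k : ℝ) + 1) := h1
      have h4 : E (x k) ≤ m + 1 / ((k : ℝ) + 1) := hxS k
      linarith
    have h5 := hsle k _ h2
    have h6 := hN (x j) (x k)
    have h7 : s j ≤ L := le_ciSup hsbdd j
    have h8 := hxN j
    have h9 := hxN k
    have := hanti hjk
    linarith

/-- Clarkson's inequality for exponents `r ≥ 2`. -/
theorem clarkson_rpow {E : Type*} [NormedAddCommGroup E] [InnerProductSpace ℝ E] {r : ℝ}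
    (hr : 2 ≤ r) (a b : E) :
    ‖(1 / 2 : ℝ) • (a + b)‖ ^ r + ‖(1 / 2 : ℝ) • (a - b)‖ ^ r ≤ (‖a‖ ^ r + ‖b‖ ^ r) / 2 := by
  have hr2 : 1 ≤ r / 2 := by linarith
  have e : ∀ v : E, ‖v‖ ^ r = (‖v‖ ^ 2) ^ (r / 2) := fun v => by
    rw [← Real.rpow_natCast, ← Real.rpow_mul (norm_nonneg v)]
    congr 1
    push_cast
    ring
  have hpar : ‖(1 / 2 : ℝ) • (a + b)‖ ^ 2 + ‖(1 / 2 : ℝ) • (a - b)‖ ^ 2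
      = 1 / 2 * ‖a‖ ^ 2 + 1 / 2 * ‖b‖ ^ 2 := by
    have := parallelogram_law_with_norm ℝ a b
    simp only [norm_smul, Real.norm_eq_abs, mul_pow, sq_abs]
    nlinarith
  rw [e, e, e a, e b]
  -- Since `r/2 ≥ 1`, the power `t ↦ t^(r/2)` is superadditive; after the parallelogram law its
  -- convexity gives the right side.
  refine (Real.add_rpow_le_rpow_add (by positivity) (by positivity) hr2).trans ?_
  rw [hpar]
  have := (convexOn_rpow hr2).2 (Set.mem_Ici.2 (sq_nonneg ‖a‖)) (Set.mem_Ici.2 (sq_nonneg ‖b‖))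
    (by norm_num : (0 : ℝ) ≤ 1 / 2) (by norm_num : (0 : ℝ) ≤ 1 / 2) (by norm_num)
  simp only [smul_eq_mul] at this
  linarith

end Minimization

/-! ### Real integrals of powers and `eLpNorm` -/

section PowerIntegrals

variable {α E : Type*} [MeasurableSpace α] {μ : Measure α} [NormedAddCommGroup E]

theorem MeasureTheory.MemLp.integrable_norm_rpow_ofReal {v : α → E} {r : ℝ} (hr : 0 < r)
    (hv : MemLp v (ENNReal.ofReal r) μ) : Integrable (fun x => ‖v x‖ ^ r) μ := by
  have := hv.integrable_norm_rpow (by simpa using hr) ENNReal.ofReal_ne_top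
  rwa [ENNReal.toReal_ofReal hr.le] at this

theorem MeasureTheory.MemLp.integrable_norm_sq {v : α → E} (hv : MemLp v 2 μ) :
    Integrable (fun x => ‖v x‖ ^ 2) μ := by
  have := hv.integrable_norm_rpow (by norm_num) (by norm_num)
  simpa using this

theorem eLpNorm_ofReal_rpow {v : α → E} {r : ℝ} (hr : 0 < r) :
    eLpNorm v (ENNReal.ofReal r) μ ^ r = ∫⁻ x, ‖v x‖ₑ ^ r ∂μ := by
  have := eLpNorm_nnreal_pow_eq_lintegral (f := v) (μ := μ) (p := r.toNNReal) (by simpa using hr)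
  rwa [Real.coe_toNNReal _ hr.le] at this

theorem eLpNorm_ofReal_rpow_eq_ofReal_integral {v : α → E} {r : ℝ} (hr : 0 < r)
    (hv : MemLp v (ENNReal.ofReal r) μ) :
    eLpNorm v (ENNReal.ofReal r) μ ^ r = ENNReal.ofReal (∫ x, ‖v x‖ ^ r ∂μ) := by
  rw [eLpNorm_ofReal_rpow hr, ofReal_integral_eq_lintegral_ofReal
    (hv.integrable_norm_rpow_ofReal hr) (Eventually.of_forall fun x => by positivity)]
  refine lintegral_congr fun x => ?_
  rw [← ENNReal.ofReal_rpow_of_nonneg (norm_nonneg _) hr.le, ofReal_norm]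

theorem eLpNorm_le_of_integral_half_le [NormedSpace ℝ E] {v : α → E} {r B : ℝ} (hr : 0 < r)
    (hv : MemLp v (ENNReal.ofReal r) μ) (h : ∫ x, ‖(1 / 2 : ℝ) • v x‖ ^ r ∂μ ≤ B) :
    eLpNorm v (ENNReal.ofReal r) μ ≤ 2 * ENNReal.ofReal B ^ (1 / r) := by
  have h1 := eLpNorm_ofReal_rpow_eq_ofReal_integral hr (hv.const_smul (1 / 2 : ℝ))
  have h2 : eLpNorm ((1 / 2 : ℝ) • v) (ENNReal.ofReal r) μ ^ r ≤ ENNReal.ofReal B := by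
    rw [h1]
    exact ENNReal.ofReal_le_ofReal h
  have h3 : v = (2 : ℝ) • ((1 / 2 : ℝ) • v) := by rw [smul_smul]; norm_num
  rw [h3, eLpNorm_const_smul]
  have e : ‖(2 : ℝ)‖ₑ = 2 := by rw [Real.enorm_of_nonneg (by norm_num)]; simp
  rw [e]
  gcongr
  rw [one_div r]
  exact (ENNReal.le_rpow_inv_iff hr).2 h2

end PowerIntegrals

/-! ### Growth of the nonlinearity and its potential -/

section Nonlinearity

variable {n : ℕ} {p α lamp Lamp Lama : ℝ} {f : Rn n → Rn n} {F : Rn n → ℝ}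

theorem HypF0.continuous (hF : HypF0 p f F) : Continuous F := hF.contDiff.continuous

theorem HypF0.continuous_gradient (hF : HypF0 p f F) : Continuous f := by
  have e : f = fun v => (InnerProductSpace.toDual ℝ (Rn n)).symm (fderiv ℝ F v) := by
    funext v
    exact (hF.grad v).gradient.symm
  rw [e]
  exact (InnerProductSpace.toDual ℝ (Rn n)).symm.continuous.comp
    (hF.contDiff.continuous_fderiv one_ne_zero)

theorem HypF0.nonneg (hF : HypF0 p f F) (v : Rn n) : 0 ≤ F v := by
  obtain ⟨μ, hμ, h⟩ := hF.lower
  exact (by positivity : (0 : ℝ) ≤ μ * ‖v‖ ^ (p + 1)).trans (h v)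

theorem rpow_le_add_rpow_of_le {t α p : ℝ} (ht : 0 ≤ t) (h1 : 1 ≤ α) (h2 : α ≤ p) :
    t ^ α ≤ t + t ^ p := by
  rcases le_total t 1 with h | h
  · have h3 : t ^ α ≤ t ^ (1 : ℝ) := Real.rpow_le_rpow_of_exponent_ge' ht h (by norm_num) h1
    rw [Real.rpow_one] at h3
    linarith [Real.rpow_nonneg ht p]
  · linarith [Real.rpow_le_rpow_of_exponent_le h h2]

theorem HypF1.one_lt_p (hf : HypF1 p α lamp Lamp Lama f) : 1 < p := hf.one_lt.trans_le hf.le_p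

theorem HypF1.const_nonneg (hf : HypF1 p α lamp Lamp Lama f) : 0 ≤ Lamp + Lama := by
  linarith [hf.lamp_pos, hf.lamp_le, hf.Lama_nonneg]

theorem HypF1.norm_le (hf : HypF1 p α lamp Lamp Lama f) (v : Rn n) :
    ‖f v‖ ≤ (Lamp + Lama) * (‖v‖ + ‖v‖ ^ p) := by
  have h1 := rpow_le_add_rpow_of_le (norm_nonneg v) hf.one_lt.le hf.le_p
  have h2 : 0 ≤ Lamp := hf.lamp_pos.le.trans hf.lamp_le
  have h3 := mul_le_mul_of_nonneg_left h1 hf.Lama_nonneg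
  have h4 := mul_nonneg h2 (norm_nonneg v)
  linarith [hf.upper v]

/-- `|f(v)| |w|` is controlled by the powers `2` and `p+1` of any bound for `|v|` and `|w|`. -/
theorem HypF1.norm_mul_le (hf : HypF1 p α lamp Lamp Lama f) {v : Rn n} {s t : ℝ}
    (hv : ‖v‖ ≤ s) (ht : t ≤ s) :
    ‖f v‖ * t ≤ (Lamp + Lama) * (s ^ (p + 1) + s ^ 2) := by
  have hs : 0 ≤ s := (norm_nonneg v).trans hv
  have hp : 0 < p := by linarith [hf.one_lt_p]
  have h1 : ‖v‖ ^ p ≤ s ^ p := Real.rpow_le_rpow (norm_nonneg v) hv hp.le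
  have h2 : s ^ (p + 1) = s ^ p * s := Real.rpow_add_one' hs (by linarith)
  calc ‖f v‖ * t ≤ ‖f v‖ * s := by gcongr
    _ ≤ ((Lamp + Lama) * (s + s ^ p)) * s := by
        gcongr
        refine (hf.norm_le v).trans ?_
        have := hf.const_nonneg
        gcongr
    _ = _ := by rw [h2]; ring

/-- The mean value theorem along the segment from `0` to `v` gives `F(v) = f(cv)·v` with `0 < c <
1`, so the growth of `f` controls `F`. -/
theorem HypF0.le_of_hypF1 (hF : HypF0 p f F) (hf : HypF1 p α lamp Lamp Lama f) (v : Rn n) :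
    F v ≤ (Lamp + Lama) * (‖v‖ ^ (p + 1) + ‖v‖ ^ 2) := by
  have d : ∀ t : ℝ, HasDerivAt (fun t : ℝ => F (t • v)) (inner ℝ (f (t • v)) v) t := by
    intro t
    have d1 : HasDerivAt (fun t : ℝ => t • v) v t := by
      simpa using (hasDerivAt_id t).smul_const v
    have h1 := (hF.grad (t • v)).hasFDerivAt.comp_hasDerivAt t d1
    rwa [InnerProductSpace.toDual_apply_apply] at h1
  obtain ⟨c, hc, h⟩ := exists_hasDerivAt_eq_slope _ _ (zero_lt_one' ℝ)
    (fun t _ => (d t).continuousAt.continuousWithinAt) (fun t _ => d t)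
  simp only [one_smul, zero_smul, hF.map_zero, sub_zero, div_one] at h
  rw [← h]
  refine (real_inner_le_norm _ _).trans (hf.norm_mul_le ?_ le_rfl)
  rw [norm_smul, Real.norm_of_nonneg hc.1.le]
  exact mul_le_of_le_one_left (norm_nonneg v) hc.2.le

end Nonlinearity

/-! ### The convex energy and its minimiser -/

section Energy

variable {n : ℕ} {p α lamp Lamp Lama d : ℝ} {f : Rn n → Rn n} {F : Rn n → ℝ}
  {ε₁ εf : Rn n → ℝ} {U₀ : Rn n → Rn n}

theorem Integrable.mul_of_memLp_top {ε g : Rn n → ℝ} (hε : MemLp ε ⊤ volume)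
    (hg : Integrable g) : Integrable (fun x => ε x * g x) :=
  hg.smul_of_top_right hε

/-- The integrability class in which the energy is finite. -/
structure IsAdmissible (p : ℝ) (v : Rn n → Rn n) : Prop where
  two : MemLp v 2 volume
  pow : MemLp v (ENNReal.ofReal (p + 1)) volume

namespace IsAdmissible

variable {v w : Rn n → Rn n}

theorem add (hv : IsAdmissible p v) (hw : IsAdmissible p w) :
    IsAdmissible p (fun x => v x + w x) :=
  ⟨hv.two.add hw.two, hv.pow.add hw.pow⟩

theorem const_smul (hv : IsAdmissible p v) (c : ℝ) : IsAdmissible p (fun x => c • v x) :=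
  ⟨hv.two.const_smul c, hv.pow.const_smul c⟩

theorem sub (hv : IsAdmissible p v) (hw : IsAdmissible p w) :
    IsAdmissible p (fun x => v x - w x) :=
  ⟨hv.two.sub hw.two, hv.pow.sub hw.pow⟩

theorem congr (hv : IsAdmissible p v) (h : v =ᵐ[volume] w) : IsAdmissible p w :=
  ⟨hv.two.ae_eq h, hv.pow.ae_eq h⟩

theorem integrable_powers (hp : 1 < p) (hv : IsAdmissible p v) :
    Integrable fun x => ‖v x‖ ^ (p + 1) + ‖v x‖ ^ 2 :=
  (hv.pow.integrable_norm_rpow_ofReal (by linarith)).add hv.two.integrable_norm_sq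

theorem integrable_potential (hv : IsAdmissible p v) (hF : HypF0 p f F)
    (hf : HypF1 p α lamp Lamp Lama f) : Integrable fun x => F (v x) := by
  refine Integrable.mono' ((hv.integrable_powers hf.one_lt_p).const_mul (Lamp + Lama))
    (hF.continuous.comp_aestronglyMeasurable hv.two.1) (Eventually.of_forall fun x => ?_)
  rw [Real.norm_of_nonneg (hF.nonneg _)]
  exact hF.le_of_hypF1 hf _

theorem integrable_norm_add_norm_powers (hp : 1 < p) (hv : IsAdmissible p v)
    (hw : IsAdmissible p w) :
    Integrable fun x => (‖v x‖ + ‖w x‖) ^ (p + 1) + (‖v x‖ + ‖w x‖) ^ 2 := by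
  have h2 : MemLp (fun x => ‖v x‖ + ‖w x‖) 2 volume := hv.two.norm.add hw.two.norm
  have hq : MemLp (fun x => ‖v x‖ + ‖w x‖) (ENNReal.ofReal (p + 1)) volume :=
    hv.pow.norm.add hw.pow.norm
  have h := (hq.integrable_norm_rpow_ofReal (by linarith)).add h2.integrable_norm_sq
  refine h.congr (Eventually.of_forall fun x => ?_)
  simp only [Pi.add_apply]
  rw [Real.norm_of_nonneg (by positivity)]

theorem integrable_inner (hv : IsAdmissible p v) (hw : IsAdmissible p w) (hF : HypF0 p f F)
    (hf : HypF1 p α lamp Lamp Lama f) : Integrable fun x => inner ℝ (f (v x)) (w x) := by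
  refine Integrable.mono'
    ((hv.integrable_norm_add_norm_powers hf.one_lt_p hw).const_mul (Lamp + Lama))
    ((hF.continuous_gradient.comp_aestronglyMeasurable hv.two.1).inner hw.two.1)
    (Eventually.of_forall fun x => (norm_inner_le_norm _ _).trans ?_)
  exact hf.norm_mul_le (le_add_of_nonneg_right (norm_nonneg _))
    (le_add_of_nonneg_left (norm_nonneg _))

end IsAdmissible

theorem MemD.isAdmissible {ψ : Rn n → ℝ} (h : MemD p ψ) : IsAdmissible p (weakGradient ψ) :=
  ⟨h.1.memLp_grad, h.2.memLp_grad⟩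

theorem HypA0.isAdmissible (h : HypA0 p U₀) : IsAdmissible p U₀ := ⟨h.memLp_two, h.memLp_p⟩

/-- The energy density in terms of the total field `y = U₀ + ∇φ`. -/
noncomputable def energyDensity (ε₁ εf F : Rn n → ℝ) (x y : Rn n) : ℝ :=
  εf x * F y + ε₁ x * (‖y‖ ^ 2 / 2)

theorem HypH0.memLp_smul (h : HypH0 d ε₁ εf) (hU : HypA0 p U₀) :
    MemLp (fun x => ε₁ x • U₀ x) 2 volume :=
  hU.memLp_two.smul h.memLp_one

theorem integrable_energyDensity (h : HypH0 d ε₁ εf) (hF : HypF0 p f F)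
    (hf : HypF1 p α lamp Lamp Lama f) {v : Rn n → Rn n} (hv : IsAdmissible p v) :
    Integrable fun x => energyDensity ε₁ εf F x (v x) :=
  (Integrable.mul_of_memLp_top h.memLp_f (hv.integrable_potential hF hf)).add
    (Integrable.mul_of_memLp_top h.memLp_one (hv.two.integrable_norm_sq.div_const 2))

theorem energyFinite (h : HypH0 d ε₁ εf) (hF : HypF0 p f F)
    (hf : HypF1 p α lamp Lamp Lama f) (hU : HypA0 p U₀) {ψ : Rn n → ℝ} (hψ : MemD p ψ) :
    EnergyFinite ε₁ εf F U₀ ψ :=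
  ⟨Integrable.mul_of_memLp_top h.memLp_f
      ((hU.isAdmissible.add hψ.isAdmissible).integrable_potential hF hf),
    Integrable.mul_of_memLp_top h.memLp_one (hψ.1.memLp_grad.integrable_norm_sq.div_const 2),
    Integrable.mul_of_memLp_top h.memLp_one (hU.memLp_two.integrable_inner_two hψ.1.memLp_grad)⟩

/-- Completing the square in `U₀ + ∇ψ`. The difference does not depend on `ψ`, so both functionals
have the same minimisers. -/
theorem integral_energyDensity (h : HypH0 d ε₁ εf) (hF : HypF0 p f F)
    (hf : HypF1 p α lamp Lamp Lama f) (hU : HypA0 p U₀) {ψ : Rn n → ℝ} (hψ : MemD p ψ) :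
    ∫ x, energyDensity ε₁ εf F x (U₀ x + weakGradient ψ x)
      = energy ε₁ εf F U₀ ψ + ∫ x, ε₁ x * (‖U₀ x‖ ^ 2 / 2) := by
  obtain ⟨i1, i2, i3⟩ := energyFinite h hF hf hU hψ
  have i4 : Integrable fun x => ε₁ x * (‖U₀ x‖ ^ 2 / 2) :=
    Integrable.mul_of_memLp_top h.memLp_one (hU.memLp_two.integrable_norm_sq.div_const 2)
  have e : ∀ x, energyDensity ε₁ εf F x (U₀ x + weakGradient ψ x)
      = ((εf x * F (U₀ x + weakGradient ψ x) + ε₁ x * (‖weakGradient ψ x‖ ^ 2 / 2))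
        + ε₁ x * inner ℝ (U₀ x) (weakGradient ψ x)) + ε₁ x * (‖U₀ x‖ ^ 2 / 2) := by
    intro x
    simp only [energyDensity, norm_add_sq_real]
    ring
  have i12 : Integrable fun x =>
      εf x * F (U₀ x + weakGradient ψ x) + ε₁ x * (‖weakGradient ψ x‖ ^ 2 / 2) := i1.add i2
  have i123 : Integrable fun x =>
      (εf x * F (U₀ x + weakGradient ψ x) + ε₁ x * (‖weakGradient ψ x‖ ^ 2 / 2))
        + ε₁ x * inner ℝ (U₀ x) (weakGradient ψ x) := i12.add i3
  simp only [e]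
  rw [energy, integral_add i123 i4, integral_add i12 i3, integral_add i1 i2]

theorem HypH0.energyDensity_nonneg (h : HypH0 d ε₁ εf) (hF : HypF0 p f F) :
    ∀ᵐ x, ∀ y, 0 ≤ energyDensity ε₁ εf F x y := by
  filter_upwards [h.le_one, h.le_f] with x h1 h2 y
  have := hF.nonneg y
  have h1' := h.d_pos.le.trans h1
  have h2' := h.d_pos.le.trans h2
  unfold energyDensity
  positivity

theorem energyDensity_midpoint_le (h : HypH0 d ε₁ εf) (hF : HypF0 p f F) :
    ∀ᵐ x, ∀ y z, energyDensity ε₁ εf F x ((1 / 2 : ℝ) • (y + z))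
      ≤ (energyDensity ε₁ εf F x y + energyDensity ε₁ εf F x z) / 2 := by
  filter_upwards [h.le_one, h.le_f] with x h1 h2 y z
  have h1' := h.d_pos.le.trans h1
  have h2' := h.d_pos.le.trans h2
  have c1 : F ((1 / 2 : ℝ) • (y + z)) ≤ (F y + F z) / 2 := by
    have := hF.convex.2 (Set.mem_univ y) (Set.mem_univ z) (by norm_num : (0 : ℝ) ≤ 1 / 2)
      (by norm_num : (0 : ℝ) ≤ 1 / 2) (by norm_num)
    simp only [smul_eq_mul] at this
    rw [smul_add]
    linarith
  have c2 : ‖(1 / 2 : ℝ) • (y + z)‖ ^ 2 ≤ (‖y‖ ^ 2 + ‖z‖ ^ 2) / 2 := by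
    have := parallelogram_law_with_norm ℝ y z
    simp only [norm_smul, Real.norm_eq_abs, mul_pow, sq_abs]
    nlinarith [sq_nonneg ‖y - z‖]
  have c3 := mul_le_mul_of_nonneg_left c1 h2'
  have c4 := mul_le_mul_of_nonneg_left c2 h1'
  unfold energyDensity
  linarith

/-- `F` is only convex, so uniform convexity is borrowed from `N`, which the energy dominates. It
makes a minimising sequence converge strongly, and Fatou's lemma then takes the place of weak lower
semicontinuity. -/
theorem exists_minimizer (h : HypH0 d ε₁ εf) (hF : HypF0 p f F)
    (hf : HypF1 p α lamp Lamp Lama f) (hU : HypA0 p U₀) :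
    ∃ φ, MemD p φ ∧ ∀ ψ, MemD p ψ →
      ∫ x, energyDensity ε₁ εf F x (U₀ x + weakGradient φ x)
        ≤ ∫ x, energyDensity ε₁ εf F x (U₀ x + weakGradient ψ x) := by
  have hp := hf.one_lt_p
  have hq : 0 < p + 1 := by linarith
  let X := {ψ : Rn n → ℝ // MemD p ψ}
  let total : X → Rn n → Rn n := fun ψ x => U₀ x + weakGradient ψ.1 x
  have hadm : ∀ ψ : X, IsAdmissible p (total ψ) := fun ψ =>
    hU.isAdmissible.add ψ.2.isAdmissible
  let mid : X → X → X := fun ψ ξ => ⟨_, MemD.lincomb (by linarith) ψ.2 ξ.2 (1 / 2) (1 / 2)⟩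
  have hmid : ∀ ψ ξ : X, ∀ᵐ x, total (mid ψ ξ) x = (1 / 2 : ℝ) • (total ψ x + total ξ x) := by
    intro ψ ξ
    filter_upwards [MemD.weakGradient_lincomb ψ.2 ξ.2 (1 / 2) (1 / 2)] with x hx
    simp only [total, mid, hx]
    module
  let E : X → ℝ := fun ψ => ∫ x, energyDensity ε₁ εf F x (total ψ x)
  let N : X → ℝ := fun ψ => ∫ x, (‖total ψ x‖ ^ (p + 1) + ‖total ψ x‖ ^ 2)
  let M : X → X → ℝ := fun ψ ξ => ∫ x, (‖(1 / 2 : ℝ) • (total ψ x - total ξ x)‖ ^ (p + 1)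
    + ‖(1 / 2 : ℝ) • (total ψ x - total ξ x)‖ ^ 2)
  have iE : ∀ ψ : X, Integrable fun x => energyDensity ε₁ εf F x (total ψ x) := fun ψ =>
    integrable_energyDensity h hF hf (hadm ψ)
  have iN : ∀ ψ : X, Integrable fun x => ‖total ψ x‖ ^ (p + 1) + ‖total ψ x‖ ^ 2 := fun ψ =>
    (hadm ψ).integrable_powers hp
  have hdiff : ∀ ψ ξ : X, IsAdmissible p (fun x => total ψ x - total ξ x) := fun ψ ξ =>
    (hadm ψ).sub (hadm ξ)
  have iM : ∀ ψ ξ : X, Integrable fun x =>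
      ‖(1 / 2 : ℝ) • (total ψ x - total ξ x)‖ ^ (p + 1)
        + ‖(1 / 2 : ℝ) • (total ψ x - total ξ x)‖ ^ 2 := fun ψ ξ =>
    ((hdiff ψ ξ).const_smul (1 / 2)).integrable_powers hp
  have : Nonempty X := ⟨⟨_, IsTestFunction.zero.memD p⟩⟩
  obtain ⟨μ, hμ, hFμ⟩ := hF.lower
  have hd := h.d_pos
  have hEmid : ∀ ψ ξ, E (mid ψ ξ) ≤ (E ψ + E ξ) / 2 := by
    intro ψ ξ
    have e : (E ψ + E ξ) / 2 = ∫ x, (energyDensity ε₁ εf F x (total ψ x)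
        + energyDensity ε₁ εf F x (total ξ x)) / 2 := by
      rw [integral_div, integral_add (iE ψ) (iE ξ)]
    rw [e]
    refine integral_mono_ae (iE _) (((iE ψ).add (iE ξ)).div_const 2) ?_
    filter_upwards [energyDensity_midpoint_le h hF, hmid ψ ξ] with x hx hm
    rw [hm]
    exact hx _ _
  have hNmid : ∀ ψ ξ, N (mid ψ ξ) + M ψ ξ ≤ (N ψ + N ξ) / 2 := by
    intro ψ ξ
    have e : (N ψ + N ξ) / 2 = ∫ x, ((‖total ψ x‖ ^ (p + 1) + ‖total ψ x‖ ^ 2)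
        + (‖total ξ x‖ ^ (p + 1) + ‖total ξ x‖ ^ 2)) / 2 := by
      rw [integral_div, integral_add (iN ψ) (iN ξ)]
    have e2 : N (mid ψ ξ) + M ψ ξ = ∫ x, ((‖total (mid ψ ξ) x‖ ^ (p + 1)
        + ‖total (mid ψ ξ) x‖ ^ 2) + (‖(1 / 2 : ℝ) • (total ψ x - total ξ x)‖ ^ (p + 1)
        + ‖(1 / 2 : ℝ) • (total ψ x - total ξ x)‖ ^ 2)) := by
      rw [integral_add (iN _) (iM ψ ξ)]
    rw [e, e2]
    refine integral_mono_ae ((iN _).add (iM ψ ξ)) (((iN ψ).add (iN ξ)).div_const 2) ?_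
    filter_upwards [hmid ψ ξ] with x hm
    rw [hm]
    -- Clarkson's inequality for both exponents: the modulus `M` controls the `L^(p+1)` and the `L²`
    -- distance together.
    have c1 := clarkson_rpow (r := p + 1) (by linarith) (total ψ x) (total ξ x)
    have c2 := clarkson_rpow le_rfl (total ψ x) (total ξ x)
    simp only [Real.rpow_two] at c2
    linarith
  have hN0 : ∀ ψ, 0 ≤ N ψ := by
    intro ψ
    exact integral_nonneg fun x => by positivity
  have hEN : ∀ ψ, min (d * μ) (d / 2) * N ψ ≤ E ψ := by
    intro ψ
    rw [← integral_const_mul]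
    refine integral_mono_ae ((iN ψ).const_mul _) (iE ψ) ?_
    filter_upwards [h.le_one, h.le_f] with x h1 h2
    have a1 : 0 ≤ ‖total ψ x‖ ^ (p + 1) := by positivity
    have a2 : 0 ≤ ‖total ψ x‖ ^ 2 := by positivity
    have b1 : d * (μ * ‖total ψ x‖ ^ (p + 1)) ≤ εf x * F (total ψ x) :=
      mul_le_mul h2 (hFμ _) (by positivity) (hd.le.trans h2)
    have b2 := mul_le_mul_of_nonneg_right h1 a2
    have b3 := mul_le_mul_of_nonneg_right (min_le_left (d * μ) (d / 2)) a1
    have b4 := mul_le_mul_of_nonneg_right (min_le_right (d * μ) (d / 2)) a2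
    simp only [energyDensity]
    linarith
  obtain ⟨ψ, B, hB, hEψ, hMψ⟩ :=
    exists_minimizing_seq mid E N M hEmid hNmid hN0 (by positivity) hEN
  have hnorm : ∀ (r : ℝ), 0 < r → (∀ ψ ξ : X, MemLp (fun x => total ψ x - total ξ x)
      (ENNReal.ofReal r) volume) → (∀ ψ ξ : X,
      ∫ x, ‖(1 / 2 : ℝ) • (total ψ x - total ξ x)‖ ^ r ≤ M ψ ξ) →
      ∀ j k, k ≤ j → eLpNorm (weakGradient (ψ j).1 - weakGradient (ψ k).1) (ENNReal.ofReal r)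
        volume ≤ 2 * ENNReal.ofReal (B k) ^ (1 / r) := by
    intro r hr hm hle j k hjk
    have e : weakGradient (ψ j).1 - weakGradient (ψ k).1
        = fun x => total (ψ j) x - total (ψ k) x := by
      funext x
      simp [total]
    rw [e]
    exact eLpNorm_le_of_integral_half_le hr (hm _ _) ((hle _ _).trans (hMψ j k hjk))
  have hlim : ∀ r : ℝ, 0 < r →
      Tendsto (fun k => 2 * ENNReal.ofReal (B k) ^ (1 / r)) atTop (𝓝 0) := by
    intro r hr
    have h1 := ENNReal.tendsto_ofReal hB
    have h2 := ((ENNReal.continuous_rpow_const (y := 1 / r)).tendsto _).comp h1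
    have h3 := ENNReal.Tendsto.const_mul (a := 2) h2 (Or.inr (by norm_num))
    rw [ENNReal.ofReal_zero, ENNReal.zero_rpow_of_pos (by positivity), mul_zero] at h3
    exact h3
  have hn2 := hnorm 2 two_pos (fun ψ ξ => by simpa using (hdiff ψ ξ).two) (fun ψ ξ => by
    refine integral_mono ?_ (iM ψ ξ) fun x => ?_
    · simpa using ((hdiff ψ ξ).const_smul (1 / 2)).two.integrable_norm_sq
    · simp only [Real.rpow_two]
      exact le_add_of_nonneg_left (by positivity))
  have hnq := hnorm (p + 1) hq (fun ψ ξ => (hdiff ψ ξ).pow) (fun ψ ξ => by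
    refine integral_mono ?_ (iM ψ ξ) fun x => ?_
    · exact ((hdiff ψ ξ).const_smul (1 / 2)).pow.integrable_norm_rpow_ofReal hq
    · exact le_add_of_nonneg_right (by positivity))
  have hpos : ∀ k : ℕ, (0 : ℝ≥0∞) < 2⁻¹ ^ k := fun k => ENNReal.pow_pos (by simp) k
  -- A single subsequence with geometric, hence summable, bounds in both norms: it converges almost
  -- everywhere, and the same limit serves both exponents.
  obtain ⟨σ, hσ, hσB⟩ := extraction_forall_of_eventually (fun k : ℕ =>
    ((hlim 2 two_pos).eventually (gt_mem_nhds (hpos k))).and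
      ((hlim (p + 1) hq).eventually (gt_mem_nhds (hpos k))))
  set w : ℕ → Rn n → Rn n := fun k => weakGradient (ψ (σ k)).1 with hw
  have hsum : ∑' k : ℕ, (2 * 2⁻¹ ^ k : ℝ≥0∞) ≠ ⊤ := by
    rw [ENNReal.tsum_mul_left, ENNReal.tsum_geometric]
    exact ENNReal.mul_ne_top (by norm_num) (by simp)
  have cauchy : ∀ r : ℝ≥0∞, 1 ≤ r → (∀ k, AEStronglyMeasurable (w k) volume) →
      (∀ N j, N ≤ j → eLpNorm (w j - w N) r volume < 2⁻¹ ^ N) → ∀ N j k, N ≤ j → N ≤ k →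
      eLpNorm (w j - w k) r volume < 2 * 2⁻¹ ^ N := by
    intro r hr hm hN N j k hj hk
    have e : w j - w k = (w j - w N) - (w k - w N) := by simp
    rw [e, two_mul]
    exact (eLpNorm_sub_le ((hm j).sub (hm N)) ((hm k).sub (hm N)) hr).trans_lt
      (ENNReal.add_lt_add (hN N j hj) (hN N k hk))
  have wm : ∀ k, AEStronglyMeasurable (w k) volume := fun k => (ψ (σ k)).2.1.memLp_grad.1
  have c2 := cauchy 2 (by norm_num) wm (fun N j hj => by
    have := (hn2 _ _ (hσ.monotone hj)).trans_lt (hσB N).1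
    simpa [hw] using this)
  have cq := cauchy (ENNReal.ofReal (p + 1)) (by rw [ENNReal.one_le_ofReal]; linarith) wm
    (fun N j hj => (hnq _ _ (hσ.monotone hj)).trans_lt (hσB N).2)
  obtain ⟨G, hG, hGlim⟩ := exists_stronglyMeasurable_limit_of_tendsto_ae wm
    (Lp.ae_tendsto_of_cauchy_eLpNorm wm (by norm_num) hsum c2)
  obtain ⟨φ, hφ, hφG⟩ := exists_memD_of_tendsto (by linarith) (fun k => (ψ (σ k)).2)
    hG.aestronglyMeasurable (Lp.cauchy_tendsto_of_tendsto wm G hsum c2 hGlim)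
    (Lp.cauchy_tendsto_of_tendsto wm G hsum cq hGlim)
  refine ⟨φ, hφ, fun ξ hξ => ?_⟩
  have hnn := h.energyDensity_nonneg hF
  have Enn : ∀ ψ : X, 0 ≤ E ψ := fun ψ => integral_nonneg_of_ae (hnn.mono fun x hx => hx _)
  have toL : ∀ ψ : X, ENNReal.ofReal (E ψ)
      = ∫⁻ x, ENNReal.ofReal (energyDensity ε₁ εf F x (total ψ x)) := fun ψ =>
    ofReal_integral_eq_lintegral_ofReal (iE ψ) (hnn.mono fun x hx => hx _)
  have pointwise : ∀ᵐ x, Tendsto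
      (fun k => ENNReal.ofReal (energyDensity ε₁ εf F x (total (ψ (σ k)) x))) atTop
      (𝓝 (ENNReal.ofReal (energyDensity ε₁ εf F x (total ⟨φ, hφ⟩ x)))) := by
    filter_upwards [hGlim, hφG] with x h1 h2
    have h3 : Tendsto (fun k => total (ψ (σ k)) x) atTop (𝓝 (total ⟨φ, hφ⟩ x)) := by
      have := h1.const_add (U₀ x)
      simpa only [total, h2] using this
    have hc : Continuous (energyDensity ε₁ εf F x) :=
      (continuous_const.mul hF.continuous).add
        (continuous_const.mul ((continuous_norm.pow 2).div_const 2))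
    exact ENNReal.tendsto_ofReal ((hc.tendsto _).comp h3)
  have key : ENNReal.ofReal (E ⟨φ, hφ⟩) ≤ ENNReal.ofReal (E ⟨ξ, hξ⟩) := by
    rw [toL]
    -- The density is nonnegative almost everywhere and continuous in the field, so it converges
    -- pointwise along the subsequence.
    have fatou := lintegral_liminf_le' (u := atTop) (μ := (volume : Measure (Rn n)))
      (f := fun k x => ENNReal.ofReal (energyDensity ε₁ εf F x (total (ψ (σ k)) x)))
      (fun k => (iE _).1.aemeasurable.ennreal_ofReal)
    have e : ∫⁻ x, liminf (fun k => ENNReal.ofReal (energyDensity ε₁ εf F x (total (ψ (σ k)) x)))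
        atTop = ∫⁻ x, ENNReal.ofReal (energyDensity ε₁ εf F x (total ⟨φ, hφ⟩ x)) :=
      lintegral_congr_ae (pointwise.mono fun x hx => hx.liminf_eq)
    rw [e] at fatou
    refine fatou.trans ?_
    simp only [← toL]
    have t : Tendsto (fun k : ℕ => ENNReal.ofReal (E ⟨ξ, hξ⟩ + 1 / ((σ k : ℝ) + 1))) atTop
        (𝓝 (ENNReal.ofReal (E ⟨ξ, hξ⟩))) := by
      refine ENNReal.tendsto_ofReal ?_
      have := (tendsto_one_div_add_atTop_nhds_zero_nat (𝕜 := ℝ)).comp hσ.tendsto_atTop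
      simpa using this.const_add (E ⟨ξ, hξ⟩)
    rw [← t.liminf_eq]
    exact liminf_le_liminf (Eventually.of_forall fun k =>
      ENNReal.ofReal_le_ofReal (hEψ (σ k) ⟨ξ, hξ⟩))
  exact (ENNReal.ofReal_le_ofReal_iff (Enn _)).1 key

end Energy

/-! ### The Euler–Lagrange equation -/

section EulerLagrange

variable {n : ℕ} {p α lamp Lamp Lama d : ℝ} {f : Rn n → Rn n} {F : Rn n → ℝ}
  {ε₁ εf : Rn n → ℝ} {U₀ : Rn n → Rn n}

/-- Differentiation under the integral. For `|t| < 1` the field is bounded by `|v| + |w|`, whose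
powers `p+1` and `2` are integrable and dominate the derivative. -/
theorem hasDerivAt_integral_energyDensity (h : HypH0 d ε₁ εf) (hF : HypF0 p f F)
    (hf : HypF1 p α lamp Lamp Lama f) {v w : Rn n → Rn n} (hv : IsAdmissible p v)
    (hw : IsAdmissible p w) :
    HasDerivAt (fun t : ℝ => ∫ x, energyDensity ε₁ εf F x (v x + t • w x))
      (∫ x, (εf x * inner ℝ (f (v x)) (w x) + ε₁ x * inner ℝ (v x) (w x))) 0 := by
  have hline : ∀ t : ℝ, IsAdmissible p (fun x => v x + t • w x) := fun t =>
    hv.add (hw.const_smul t)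
  have hpow := hv.integrable_norm_add_norm_powers hf.one_lt_p hw
  have key := hasDerivAt_integral_of_dominated_loc_of_deriv_le
    (μ := (volume : Measure (Rn n))) (x₀ := (0 : ℝ))
    (F := fun t x => energyDensity ε₁ εf F x (v x + t • w x))
    (F' := fun t x => εf x * inner ℝ (f (v x + t • w x)) (w x)
      + ε₁ x * inner ℝ (v x + t • w x) (w x))
    (bound := fun x => ‖εf x‖ * ((Lamp + Lama) *
        ((‖v x‖ + ‖w x‖) ^ (p + 1) + (‖v x‖ + ‖w x‖) ^ 2))
      + ‖ε₁ x‖ * ((‖v x‖ + ‖w x‖) ^ (p + 1) + (‖v x‖ + ‖w x‖) ^ 2))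
    (Metric.ball_mem_nhds 0 one_pos)
    (Eventually.of_forall fun t => (integrable_energyDensity h hF hf (hline t)).1)
    (integrable_energyDensity h hF hf (hline 0)) ?_ ?_ ?_ ?_
  · simpa using key.2
  · exact ((Integrable.mul_of_memLp_top h.memLp_f ((hline 0).integrable_inner hw hF hf)).add
      (Integrable.mul_of_memLp_top h.memLp_one ((hline 0).two.integrable_inner_two hw.two))).1
  · refine Eventually.of_forall fun x t ht => ?_
    have ht' : |t| ≤ 1 := by simpa using (Metric.mem_ball.1 ht).le
    have h1 : ‖v x + t • w x‖ ≤ ‖v x‖ + ‖w x‖ := by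
      refine (norm_add_le _ _).trans ?_
      rw [norm_smul, Real.norm_eq_abs]
      gcongr
      exact mul_le_of_le_one_left (norm_nonneg _) ht'
    have h2 : ‖w x‖ ≤ ‖v x‖ + ‖w x‖ := le_add_of_nonneg_left (norm_nonneg _)
    refine (norm_add_le _ _).trans ?_
    rw [norm_mul, norm_mul]
    gcongr
    · exact (norm_inner_le_norm _ _).trans (hf.norm_mul_le h1 h2)
    · refine (norm_inner_le_norm _ _).trans ?_
      have h3 : ‖v x + t • w x‖ * ‖w x‖ ≤ (‖v x‖ + ‖w x‖) * (‖v x‖ + ‖w x‖) :=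
        mul_le_mul h1 h2 (norm_nonneg _) (by positivity)
      have h4 : 0 ≤ (‖v x‖ + ‖w x‖) ^ (p + 1) := by positivity
      nlinarith
  · exact (Integrable.mul_of_memLp_top h.memLp_f.norm (hpow.const_mul _)).add
      (Integrable.mul_of_memLp_top h.memLp_one.norm hpow)
  · refine Eventually.of_forall fun x t _ => ?_
    have d1 : HasDerivAt (fun t : ℝ => v x + t • w x) (w x) t := by
      simpa using ((hasDerivAt_id t).smul_const (w x)).const_add (v x)
    have d2 := (hF.grad (v x + t • w x)).hasFDerivAt.comp_hasDerivAt t d1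
    rw [InnerProductSpace.toDual_apply_apply] at d2
    have d3 := (d1.norm_sq.div_const 2).const_mul (ε₁ x)
    have d4 := (d2.const_mul (εf x)).add d3
    refine d4.congr_deriv ?_
    ring

theorem isWeakSolution_of_isMinimizer (h : HypH0 d ε₁ εf) (hF : HypF0 p f F)
    (hf : HypF1 p α lamp Lamp Lama f) (hU : HypA0 p U₀) {φ : Rn n → ℝ} (hφ : MemD p φ)
    (hmin : ∀ ψ, MemD p ψ → ∫ x, energyDensity ε₁ εf F x (U₀ x + weakGradient φ x)
        ≤ ∫ x, energyDensity ε₁ εf F x (U₀ x + weakGradient ψ x)) :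
    IsWeakSolution p ε₁ εf f U₀ φ := by
  refine ⟨hφ, fun η hη => ?_⟩
  have hv := hU.isAdmissible.add hφ.isAdmissible
  have hw := hη.isAdmissible
  have hd := hasDerivAt_integral_energyDensity h hF hf hv hw
  have hloc : IsLocalMin (fun t : ℝ => ∫ x, energyDensity ε₁ εf F x
      ((U₀ x + weakGradient φ x) + t • weakGradient η x)) 0 := by
    refine Eventually.of_forall fun t => ?_
    have h1 := hmin _ (MemD.lincomb (by linarith [hf.one_lt_p]) hφ hη 1 t)
    have e : ∫ x, energyDensity ε₁ εf F x
        (U₀ x + weakGradient (fun x => 1 * φ x + t * η x) x)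
        = ∫ x, energyDensity ε₁ εf F x ((U₀ x + weakGradient φ x) + t • weakGradient η x) := by
      refine integral_congr_ae ?_
      filter_upwards [hφ.weakGradient_lincomb hη 1 t] with x hx
      rw [hx, one_smul, add_assoc]
    rw [e] at h1
    simpa using h1
  have h0 := hloc.hasDerivAt_eq_zero hd
  rwa [integral_add (Integrable.mul_of_memLp_top h.memLp_f (hv.integrable_inner hw hF hf))
    (Integrable.mul_of_memLp_top h.memLp_one (hv.two.integrable_inner_two hw.two))] at h0

theorem isWeakSolution_zero_of_weakGradient_ae_eq_zero {φ : Rn n → ℝ}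
    (hφ : IsWeakSolution p ε₁ εf f U₀ φ) (h0 : weakGradient φ =ᵐ[volume] 0) :
    IsWeakSolution p ε₁ εf f U₀ (fun _ => 0) := by
  refine ⟨IsTestFunction.zero.memD p, fun η hη => ?_⟩
  have hz : weakGradient (fun _ : Rn n => (0 : ℝ)) =ᵐ[volume] weakGradient φ := by
    refine (IsTestFunction.zero.hasWeakGradient.weakGradient_ae_eq).trans
      (EventuallyEq.trans ?_ h0.symm)
    exact Eventually.of_forall fun x => by simp
  refine Eq.trans ?_ (hφ.2 η hη)
  congr 1
  · refine integral_congr_ae ?_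
    filter_upwards [hz] with x hx
    rw [hx]
  · refine integral_congr_ae ?_
    filter_upwards [hz] with x hx
    rw [hx]

end EulerLagrange

/-! ### The energy estimate -/

section Estimate

variable {n : ℕ} {p α lamp Lamp Lama d : ℝ} {f : Rn n → Rn n} {F : Rn n → ℝ}
  {ε₁ εf : Rn n → ℝ} {U₀ : Rn n → Rn n}

/-- A form of Young's inequality with no `|u|²` on the right: with `u = U₀` and `v - u = ∇φ`, the
quadratic contribution falls on `|∇φ|²` and can be absorbed. This keeps `‖U₀‖₂` out of the final
bound. -/
theorem HypF1.young_le (hf : HypF1 p α lamp Lamp Lama f) {δ : ℝ} (hδ : 0 < δ) (hδ' : δ ≤ 1 / 2)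
    (u v : Rn n) :
    ‖f v‖ * ‖u‖ ≤ δ * (Lamp + Lama) * ‖v‖ ^ (p + 1) + 4 * δ * Lama * ‖v - u‖ ^ 2
      + δ ^ (-p) * (Lamp + Lama) * (‖u‖ ^ (p + 1) + ‖u‖ ^ (α + 1)) := by
  have hLp : 0 ≤ Lamp := hf.lamp_pos.le.trans hf.lamp_le
  have hLa := hf.Lama_nonneg
  have hα := hf.one_lt
  have hp := hf.one_lt_p
  set a := ‖v‖ with ha
  set s := ‖u‖ with hs
  have ha0 : 0 ≤ a := norm_nonneg v
  have hs0 : 0 ≤ s := norm_nonneg u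
  have ap : a ^ (p + 1) = a ^ p * a := Real.rpow_add_one' ha0 (by linarith)
  have sp : s ^ (p + 1) = s ^ p * s := Real.rpow_add_one' hs0 (by linarith)
  have sα : s ^ (α + 1) = s ^ α * s := Real.rpow_add_one' hs0 (by linarith)
  have h0 : ‖f v‖ * s ≤ (Lamp * a ^ p + Lama * a ^ α) * s :=
    mul_le_mul_of_nonneg_right (hf.upper v) hs0
  have ap0 : 0 ≤ a ^ p := by positivity
  have aα0 : 0 ≤ a ^ α := by positivity
  have sp0 : 0 ≤ s ^ (p + 1) := by positivity
  have sα0 : 0 ≤ s ^ (α + 1) := by positivity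
  have hD : 0 < δ ^ (-p) := by positivity
  refine h0.trans ?_
  -- If `|u| ≤ δ|v| ≤ |v|/2`, then `|v| ≤ 2|v - u|`, which disposes of the quadratic term. Otherwise
  -- `|v| ≤ δ⁻¹|u|` and everything is bounded by powers of `|u|`.
  rcases le_total s (δ * a) with hsa | hsa
  · have h1 : (Lamp * a ^ p + Lama * a ^ α) * s ≤ (Lamp * a ^ p + Lama * a ^ α) * (δ * a) := by
      gcongr
    have h2 : a ^ α ≤ a + a ^ p := rpow_le_add_rpow_of_le ha0 hα.le hf.le_p
    have h3 : a / 2 ≤ ‖v - u‖ := by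
      have h4 := norm_sub_norm_le v u
      have h5 : δ * a ≤ 1 / 2 * a := by gcongr
      rw [← ha, ← hs] at h4
      linarith
    have h4 : a ^ 2 ≤ 4 * ‖v - u‖ ^ 2 := by nlinarith
    have h5 : Lama * a ^ α * (δ * a) ≤ Lama * (a + a ^ p) * (δ * a) := by gcongr
    have h6 : δ * Lama * a ^ 2 ≤ δ * Lama * (4 * ‖v - u‖ ^ 2) := by gcongr
    have h7 : 0 ≤ δ ^ (-p) * (Lamp + Lama) * (s ^ (p + 1) + s ^ (α + 1)) := by positivity
    rw [ap]
    nlinarith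
  · have h1 : a ≤ δ⁻¹ * s := by
      rw [inv_mul_eq_div, le_div_iff₀ hδ]
      linarith
    have hδ1 : δ ≤ 1 := by linarith
    have h2 : a ^ p ≤ δ ^ (-p) * s ^ p := by
      rw [Real.rpow_neg hδ.le, ← Real.inv_rpow hδ.le, ← Real.mul_rpow (by positivity) hs0]
      exact Real.rpow_le_rpow ha0 h1 (by linarith)
    -- The natural factor `δ^(-α)` is enlarged to `δ^(-p)`, so that the constant does not depend on
    -- `α`.
    have h3 : a ^ α ≤ δ ^ (-p) * s ^ α := by
      have h4 : a ^ α ≤ δ ^ (-α) * s ^ α := by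
        rw [Real.rpow_neg hδ.le, ← Real.inv_rpow hδ.le, ← Real.mul_rpow (by positivity) hs0]
        exact Real.rpow_le_rpow ha0 h1 (by linarith)
      refine h4.trans (mul_le_mul_of_nonneg_right ?_ (by positivity))
      exact Real.rpow_le_rpow_of_exponent_ge hδ hδ1 (by linarith [hf.le_p])
    have h5 : (Lamp * a ^ p + Lama * a ^ α) * s
        ≤ (Lamp * (δ ^ (-p) * s ^ p) + Lama * (δ ^ (-p) * s ^ α)) * s := by gcongr
    have e : (Lamp * (δ ^ (-p) * s ^ p) + Lama * (δ ^ (-p) * s ^ α)) * s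
        = δ ^ (-p) * (Lamp * s ^ (p + 1) + Lama * s ^ (α + 1)) := by rw [sp, sα]; ring
    have h6 : δ ^ (-p) * (Lamp * s ^ (p + 1) + Lama * s ^ (α + 1))
        ≤ δ ^ (-p) * ((Lamp + Lama) * (s ^ (p + 1) + s ^ (α + 1))) := by
      gcongr
      nlinarith
    have h7 : 0 ≤ δ * (Lamp + Lama) * a ^ (p + 1) + 4 * δ * Lama * ‖v - u‖ ^ 2 := by positivity
    linarith

/-- As `|v - u| ≤ 2 max(|u|, |v|)`, the larger of the two norms carries all `p+1` powers. The mixed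
term of the theorem is thus reduced to `L^(p+1)` norms. -/
theorem rpow_sub_one_mul_sq_norm_sub_le {E : Type*} [NormedAddCommGroup E] {p : ℝ} (hp : 1 < p)
    (u v : E) :
    ‖v‖ ^ (p - 1) * ‖v - u‖ ^ 2 ≤ 4 * (‖v‖ ^ (p + 1) + ‖u‖ ^ (p + 1)) := by
  have e : ∀ t : ℝ, 0 ≤ t → t ^ (p + 1) = t ^ (p - 1) * t ^ 2 := fun t ht => by
    rw [← Real.rpow_natCast t 2, ← Real.rpow_add' ht (by push_cast; linarith)]
    congr 1
    push_cast
    ring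
  have h0 := norm_sub_le v u
  have hv := e _ (norm_nonneg v)
  have hu := e _ (norm_nonneg u)
  have hv0 : 0 ≤ ‖v‖ ^ (p + 1) := by positivity
  have hu0 : 0 ≤ ‖u‖ ^ (p + 1) := by positivity
  rcases le_total ‖u‖ ‖v‖ with h | h
  · have h1 : ‖v - u‖ ^ 2 ≤ (2 * ‖v‖) ^ 2 := by gcongr; linarith
    have h2 := mul_le_mul_of_nonneg_left h1 (Real.rpow_nonneg (norm_nonneg v) (p - 1))
    linarith
  · have h1 : ‖v - u‖ ^ 2 ≤ (2 * ‖u‖) ^ 2 := by gcongr; linarith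
    have h2 : ‖v‖ ^ (p - 1) ≤ ‖u‖ ^ (p - 1) :=
      Real.rpow_le_rpow (norm_nonneg v) h (by linarith)
    have h3 := mul_le_mul h2 h1 (by positivity) (by positivity)
    linarith

theorem ae_norm_le_of_eLpNorm_top_le {ε : Rn n → ℝ} {M : ℝ}
    (h : eLpNorm ε ⊤ volume ≤ ENNReal.ofReal M) : ∀ᵐ x, ε x ≤ max M 0 := by
  rw [eLpNorm_exponent_top] at h
  filter_upwards [ae_le_eLpNormEssSup (f := ε) (μ := volume)] with x hx
  have h1 := hx.trans h
  rw [← ofReal_norm, ENNReal.ofReal_le_ofReal_iff'] at h1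
  have h2 := le_abs_self (ε x)
  rw [← Real.norm_eq_abs] at h2
  rcases h1 with h1 | h1
  · exact (h2.trans h1).trans (le_max_left _ _)
  · exact (h2.trans h1).trans (le_max_right _ _)

theorem IsAdmissible.memLp_of_between {v : Rn n → Rn n} (hv : IsAdmissible p v)
    (hα : 1 < α) (hαp : α ≤ p) : MemLp v (ENNReal.ofReal (α + 1)) volume := by
  have h0 : (0 : ℝ) < α + 1 := by linarith
  rw [← integrable_norm_rpow_iff hv.two.1 (by simpa using h0) ENNReal.ofReal_ne_top,
    ENNReal.toReal_ofReal h0.le]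
  refine Integrable.mono' (hv.integrable_powers (hα.trans_le hαp))
    ((hv.two.1.norm.aemeasurable.pow_const _).aestronglyMeasurable)
    (Eventually.of_forall fun x => ?_)
  rw [Real.norm_of_nonneg (by positivity), Real.rpow_add_one' (norm_nonneg _) (by linarith),
    Real.rpow_add_one' (norm_nonneg _) (by linarith)]
  have := mul_le_mul_of_nonneg_right (rpow_le_add_rpow_of_le (norm_nonneg (v x)) hα.le hαp)
    (norm_nonneg (v x))
  linarith

/-- The energy estimate for weak solutions, in terms of a bound `Q` for the linear functional
`∇φ ↦ ∫ ε₁ U₀·∇φ`. -/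
theorem IsWeakSolution.estimate (h : HypH0 d ε₁ εf) (hF : HypF0 p f F)
    (hf : HypF1 p α lamp Lamp Lama f) (hU : HypA0 p U₀) {φ : Rn n → ℝ}
    (hφ : IsWeakSolution p ε₁ εf f U₀ φ) {Mf δ Q : ℝ} (hMf : ∀ᵐ x, εf x ≤ Mf) (hMf0 : 0 ≤ Mf)
    (hδ : 0 < δ) (hδ' : δ ≤ 1 / 2) (hδ1 : Mf * δ * (Lamp + Lama) ≤ d * lamp / 2)
    (hδ2 : 8 * Mf * δ * Lama ≤ d)
    (hQ : |∫ x, inner ℝ (ε₁ x • U₀ x) (weakGradient φ x)|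
      ≤ Q * √(∫ x, ‖weakGradient φ x‖ ^ 2)) :
    d * lamp / 2 * (∫ x, ‖U₀ x + weakGradient φ x‖ ^ (p + 1))
        + d / 4 * (∫ x, ‖weakGradient φ x‖ ^ 2)
      ≤ Mf * δ ^ (-p) * (Lamp + Lama) * ((∫ x, ‖U₀ x‖ ^ (p + 1)) + ∫ x, ‖U₀ x‖ ^ (α + 1))
        + Q ^ 2 / d := by
  have hd := h.d_pos
  have hp := hf.one_lt_p
  have hL := hf.const_nonneg
  have hg := hφ.1.isAdmissible
  have hv := hU.isAdmissible.add hg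
  set g := weakGradient φ with hgdef
  set A₁ := ∫ x, ‖U₀ x + g x‖ ^ (p + 1) with hA₁
  set A₂ := ∫ x, ‖g x‖ ^ 2 with hA₂
  have iv := hv.pow.integrable_norm_rpow_ofReal (by linarith)
  have ig := hg.two.integrable_norm_sq
  have iU := hU.memLp_p.integrable_norm_rpow_ofReal (by linarith)
  have iUα := (hU.isAdmissible.memLp_of_between hf.one_lt hf.le_p).integrable_norm_rpow_ofReal
    (by linarith [hf.one_lt])
  have i1 := Integrable.mul_of_memLp_top h.memLp_f (hv.integrable_inner hg hF hf)
  have i2 := Integrable.mul_of_memLp_top h.memLp_one (hv.two.integrable_inner_two hg.two)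
  have i3 : Integrable fun x => inner ℝ (ε₁ x • U₀ x) (g x) :=
    (h.memLp_smul hU).integrable_inner_two hg.two
  have weak := hφ.2 φ hφ.1
  -- The bracket integrates, by the weak equation tested with `φ`, to minus the linear term. The two
  -- smallness conditions on `δ` absorb half of `dλ|U₀+∇φ|^(p+1)` and half of `d|∇φ|²`.
  have pointwise : ∀ᵐ x, d * lamp / 2 * ‖U₀ x + g x‖ ^ (p + 1) + d / 2 * ‖g x‖ ^ 2
      ≤ (εf x * inner ℝ (f (U₀ x + g x)) (g x) + ε₁ x * inner ℝ (U₀ x + g x) (g x)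
          - inner ℝ (ε₁ x • U₀ x) (g x))
        + Mf * δ ^ (-p) * (Lamp + Lama) * (‖U₀ x‖ ^ (p + 1) + ‖U₀ x‖ ^ (α + 1)) := by
    filter_upwards [h.le_one, h.le_f, hMf] with x h1 h2 h3
    have y := hf.young_le hδ hδ' (U₀ x) (U₀ x + g x)
    rw [add_sub_cancel_left] at y
    have lo := hf.lower (U₀ x + g x)
    set v := U₀ x + g x with hvdef
    have e1 : inner ℝ (f v) (g x) = inner ℝ (f v) v - inner ℝ (f v) (U₀ x) := by
      rw [← inner_sub_right, hvdef, add_sub_cancel_left]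
    have e2 : ε₁ x * inner ℝ v (g x) - inner ℝ (ε₁ x • U₀ x) (g x) = ε₁ x * ‖g x‖ ^ 2 := by
      rw [hvdef, inner_add_left, real_inner_self_eq_norm_sq, real_inner_smul_left]
      ring
    have b1 : inner ℝ (f v) (U₀ x) ≤ ‖f v‖ * ‖U₀ x‖ := real_inner_le_norm _ _
    have hv0 : 0 ≤ ‖v‖ ^ (p + 1) := by positivity
    have hg0 : 0 ≤ ‖g x‖ ^ 2 := by positivity
    have ef0 : 0 ≤ εf x := hd.le.trans h2
    have c1 : d * (lamp * ‖v‖ ^ (p + 1)) ≤ εf x * inner ℝ (f v) v :=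
      mul_le_mul h2 lo (mul_nonneg hf.lamp_pos.le hv0) ef0
    have c2 : εf x * inner ℝ (f v) (U₀ x) ≤ Mf * (‖f v‖ * ‖U₀ x‖) :=
      (mul_le_mul_of_nonneg_left b1 ef0).trans (mul_le_mul_of_nonneg_right h3 (by positivity))
    have c3 := mul_le_mul_of_nonneg_left y hMf0
    have c4 := mul_le_mul_of_nonneg_right h1 hg0
    have c5 := mul_le_mul_of_nonneg_right hδ1 hv0
    have c6 := mul_le_mul_of_nonneg_right hδ2 hg0
    rw [add_sub_assoc, e2, e1]
    linarith
  have il : Integrable fun x => d * lamp / 2 * ‖U₀ x + g x‖ ^ (p + 1) + d / 2 * ‖g x‖ ^ 2 :=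
    (iv.const_mul _).add (ig.const_mul _)
  have iUU : Integrable fun x => ‖U₀ x‖ ^ (p + 1) + ‖U₀ x‖ ^ (α + 1) := iU.add iUα
  have i12 : Integrable fun x =>
      εf x * inner ℝ (f (U₀ x + g x)) (g x) + ε₁ x * inner ℝ (U₀ x + g x) (g x) := i1.add i2
  have i123 : Integrable fun x =>
      εf x * inner ℝ (f (U₀ x + g x)) (g x) + ε₁ x * inner ℝ (U₀ x + g x) (g x)
        - inner ℝ (ε₁ x • U₀ x) (g x) := i12.sub i3
  have key := integral_mono_ae il (i123.add (iUU.const_mul _)) pointwise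
  simp only [Pi.add_apply] at key
  rw [integral_add (iv.const_mul _) (ig.const_mul _), integral_add i123 (iUU.const_mul _),
    integral_sub i12 i3, integral_add i1 i2, weak, integral_const_mul, integral_const_mul,
    integral_const_mul, integral_add iU iUα, ← hA₁, ← hA₂] at key
  have hA₂0 : 0 ≤ A₂ := integral_nonneg fun x => by positivity
  have hs := Real.sq_sqrt hA₂0
  have hq1 := neg_le_of_abs_le hQ
  -- Young's inequality spends another `d/4` of the remaining `d/2` in front of `∫ |∇φ|²`.
  have hq : Q * √A₂ ≤ d / 4 * A₂ + Q ^ 2 / d := by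
    have h5 : 0 ≤ (d / 2 * √A₂ - Q) ^ 2 / d := by positivity
    have h6 : (d / 2 * √A₂ - Q) ^ 2 / d = d / 4 * (√A₂) ^ 2 - Q * √A₂ + Q ^ 2 / d := by
      field_simp
      ring
    rw [h6, hs] at h5
    linarith
  linarith

end Estimate

/-! ### Choice of constants and the main theorem -/

theorem exists_small_pos {a b c e : ℝ} (ha : 0 ≤ a) (hb : 0 < b) (hc : 0 ≤ c) (he : 0 < e) :
    ∃ δ : ℝ, 0 < δ ∧ δ ≤ 1 / 2 ∧ a * δ ≤ b ∧ c * δ ≤ e := by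
  refine ⟨min (1 / 2) (min (b / (a + 1)) (e / (c + 1))), by positivity, min_le_left _ _, ?_, ?_⟩
  · have h1 : min (1 / 2) (min (b / (a + 1)) (e / (c + 1))) ≤ b / (a + 1) :=
      (min_le_right _ _).trans (min_le_left _ _)
    calc _ ≤ a * (b / (a + 1)) := mul_le_mul_of_nonneg_left h1 ha
      _ = b * (a / (a + 1)) := by ring
      _ ≤ b * 1 := by
          gcongr
          rw [div_le_one (by positivity)]
          linarith
      _ = b := mul_one b
  · have h1 : min (1 / 2) (min (b / (a + 1)) (e / (c + 1))) ≤ e / (c + 1) :=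
      (min_le_right _ _).trans (min_le_right _ _)
    calc _ ≤ c * (e / (c + 1)) := mul_le_mul_of_nonneg_left h1 hc
      _ = e * (c / (c + 1)) := by ring
      _ ≤ e * 1 := by
          gcongr
          rw [div_le_one (by positivity)]
          linarith
      _ = e := mul_one e

theorem lintegral_energy_norm_le {n : ℕ} {p : ℝ} (hp : 1 < p) {U g : Rn n → Rn n}
    (hU : IsAdmissible p U) (hg : IsAdmissible p g) :
    (∫⁻ x, ‖g x‖ₑ ^ 2) + (∫⁻ x, ‖U x + g x‖ₑ ^ (p - 1) * ‖g x‖ₑ ^ 2)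
      ≤ ENNReal.ofReal ((∫ x, ‖g x‖ ^ 2) + 4 * ((∫ x, ‖U x + g x‖ ^ (p + 1))
        + ∫ x, ‖U x‖ ^ (p + 1))) := by
  have iv := (hU.add hg).pow.integrable_norm_rpow_ofReal (by linarith)
  have iU := hU.pow.integrable_norm_rpow_ofReal (by linarith)
  have i : Integrable fun x => 4 * (‖U x + g x‖ ^ (p + 1) + ‖U x‖ ^ (p + 1)) :=
    (iv.add iU).const_mul 4
  have e2 : ∫⁻ x, ‖g x‖ₑ ^ 2 = ENNReal.ofReal (∫ x, ‖g x‖ ^ 2) := by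
    rw [ofReal_integral_eq_lintegral_ofReal hg.two.integrable_norm_sq
      (Eventually.of_forall fun x => by positivity)]
    refine lintegral_congr fun x => ?_
    rw [ENNReal.ofReal_pow (norm_nonneg _), ofReal_norm]
  rw [ENNReal.ofReal_add (integral_nonneg fun x => by positivity) (by positivity), e2,
    ← integral_add iv iU, ← integral_const_mul,
    ofReal_integral_eq_lintegral_ofReal i (Eventually.of_forall fun x => by positivity)]
  refine add_le_add_right (lintegral_mono fun x => ?_) _
  have h := rpow_sub_one_mul_sq_norm_sub_le hp (U x) (U x + g x)
  rw [add_sub_cancel_left] at h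
  rw [← ofReal_norm, ← ofReal_norm, ENNReal.ofReal_rpow_of_nonneg (norm_nonneg _) (by linarith),
    ← ENNReal.ofReal_pow (norm_nonneg _), ← ENNReal.ofReal_mul (by positivity)]
  exact ENNReal.ofReal_le_ofReal h

theorem theorem1 (n : ℕ) [NeZero n] (hn : 2 ≤ n) (p lamp Lamp Lama d M₁ Mf : ℝ) :
    ∃ C : ℝ≥0, ∀ (α : ℝ) (ε₁ εf : Rn n → ℝ) (f : Rn n → Rn n) (F : Rn n → ℝ)
      (U₀ : Rn n → Rn n) (b : Rn n → ℝ),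
      HypH0 d ε₁ εf →
      eLpNorm ε₁ ⊤ volume ≤ ENNReal.ofReal M₁ →
      eLpNorm εf ⊤ volume ≤ ENNReal.ofReal Mf →
      HypF0 p f F →
      HypF1 p α lamp Lamp Lama f →
      HypA0 p U₀ →
      HypA1 ε₁ U₀ b →
      HypA2 p ε₁ εf f U₀ b →
      (∀ ψ : Rn n → ℝ, MemD p ψ → EnergyFinite ε₁ εf F U₀ ψ) ∧
      ∃ φ : Rn n → ℝ, MemD p φ ∧
        (¬ weakGradient φ =ᵐ[volume] 0) ∧
        (∀ ψ : Rn n → ℝ, MemD p ψ → energy ε₁ εf F U₀ φ ≤ energy ε₁ εf F U₀ ψ) ∧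
        IsWeakSolution p ε₁ εf f U₀ φ ∧
        (∫⁻ x, ‖weakGradient φ x‖ₑ ^ 2)
            + (∫⁻ x, ‖U₀ x + weakGradient φ x‖ₑ ^ (p - 1) * ‖weakGradient φ x‖ₑ ^ 2)
          ≤ C * (eLpNorm U₀ (ENNReal.ofReal (p + 1)) volume ^ (p + 1)
              + eLpNorm U₀ (ENNReal.ofReal (α + 1)) volume ^ (α + 1)
              + eLpNorm b 2 volume ^ 2 + tripleNorm b ^ 2) := by
  -- The constant is chosen before any hypothesis is available. For inadmissible parameters the
  -- hypotheses contradict each other and any constant will do.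
  by_cases hpar : 0 < d ∧ 0 < lamp ∧ lamp ≤ Lamp ∧ 0 ≤ Lama
  swap
  · refine ⟨0, fun α ε₁ εf f F U₀ b h _ _ hF hf => absurd ?_ hpar⟩
    exact ⟨h.d_pos, hf.lamp_pos, hf.lamp_le, hf.Lama_nonneg⟩
  obtain ⟨hd, hlamp, hlampL, hLama⟩ := hpar
  have hLamp : 0 ≤ Lamp := hlamp.le.trans hlampL
  obtain ⟨K, hK⟩ := exists_enorm_integral_inner_weakGradient_le n hn
  -- `ENNReal.ofReal` sends a negative bound to `0`, so the effective bound for `ε_f` is the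
  -- positive part.
  set m := max Mf 0 with hm
  have hm0 : 0 ≤ m := le_max_right _ _
  obtain ⟨δ, hδ, hδ', hδ1, hδ2⟩ := exists_small_pos (a := m * (Lamp + Lama)) (b := d * lamp / 2)
    (c := 8 * m * Lama) (e := d) (by positivity) (by positivity) (by positivity) hd
  set C₁ := m * δ ^ (-p) * (Lamp + Lama) with hC₁
  have hC₁0 : 0 ≤ C₁ := by positivity
  -- The estimate controls `dλ/2 · A₁ + d/4 · A₂`, while `4A₁ + A₂` is needed; hence the `8`.
  set c₀ := min (d * lamp / 8) (d / 4) with hc₀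
  have hc₀0 : 0 < c₀ := by positivity
  -- The `4` accounts for `4S₁` from the mixed term; the doubling in the final constant comes from
  -- `(β + τ)² ≤ 2(β² + τ²)`.
  set C₂ := 4 + C₁ / c₀ + (K : ℝ) ^ 2 / d / c₀ with hC₂
  have hC₂0 : 0 ≤ C₂ := by positivity
  refine ⟨(2 * C₂).toNNReal, fun α ε₁ εf f F U₀ b h _ hMf hF hf hU hb hA => ?_⟩
  refine ⟨fun ψ hψ => energyFinite h hF hf hU hψ, ?_⟩
  obtain ⟨φ, hφ, hmin⟩ := exists_minimizer h hF hf hU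
  have hsol := isWeakSolution_of_isMinimizer h hF hf hU hφ hmin
  refine ⟨φ, hφ, fun h0 => hA.not_sol (isWeakSolution_zero_of_weakGradient_ae_eq_zero hsol h0),
    fun ψ hψ => ?_, hsol, ?_⟩
  · have := hmin ψ hψ
    rw [integral_energyDensity h hF hf hU hφ, integral_energyDensity h hF hf hU hψ] at this
    linarith
  have hp := hf.one_lt_p
  have hα := hf.one_lt
  have hg := hφ.isAdmissible
  set g := weakGradient φ
  set A₂ := ∫ x, ‖g x‖ ^ 2 with hA₂
  have hA₂0 : 0 ≤ A₂ := integral_nonneg fun x => by positivity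
  set A₁ := ∫ x, ‖U₀ x + g x‖ ^ (p + 1) with hA₁
  have hA₁0 : 0 ≤ A₁ := integral_nonneg fun x => by positivity
  set S₁ := ∫ x, ‖U₀ x‖ ^ (p + 1) with hS₁
  have hS₁0 : 0 ≤ S₁ := integral_nonneg fun x => by positivity
  set S₂ := ∫ x, ‖U₀ x‖ ^ (α + 1) with hS₂
  have hS₂0 : 0 ≤ S₂ := integral_nonneg fun x => by positivity
  have hbt : eLpNorm b 2 volume ≠ ⊤ := hb.memLp_two.2.ne
  have hTt : tripleNorm b ≠ ⊤ := hb.triple_lt_top.ne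
  set β := (eLpNorm b 2 volume).toReal with hβ
  set τ := (tripleNorm b).toReal with hτ
  have norm_g : (eLpNorm g 2 volume).toReal = √A₂ := by
    have h1 := eLpNorm_ofReal_rpow_eq_ofReal_integral (μ := (volume : Measure (Rn n))) (v := g)
      two_pos (by simpa using hg.two)
    simp only [ENNReal.ofReal_ofNat, Real.rpow_two, ENNReal.rpow_two] at h1
    rw [← hA₂] at h1
    have h2 := congrArg ENNReal.toReal h1
    rw [ENNReal.toReal_pow, ENNReal.toReal_ofReal hA₂0] at h2
    rw [← h2, Real.sqrt_sq ENNReal.toReal_nonneg]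
  have hQ : |∫ x, inner ℝ (ε₁ x • U₀ x) (g x)| ≤ (K * (β + τ)) * √A₂ := by
    have h1 := hK _ b (h.memLp_smul hU) hb.memLp_two hb.triple_lt_top hA.transmission φ hφ.1
    have h2 := ENNReal.toReal_mono
      (ENNReal.mul_ne_top (ENNReal.mul_ne_top ENNReal.coe_ne_top (ENNReal.add_ne_top.2 ⟨hbt, hTt⟩))
        hg.two.2.ne) h1
    rw [ENNReal.toReal_mul, ENNReal.toReal_mul, ENNReal.toReal_add hbt hTt, norm_g, toReal_enorm,
      Real.norm_eq_abs] at h2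
    exact h2
  have est := hsol.estimate h hF hf hU (ae_norm_le_of_eLpNorm_top_le hMf) hm0 hδ hδ'
    (by linarith) (by linarith) hQ
  rw [← hA₁, ← hA₂, ← hS₁, ← hS₂, ← hC₁] at est
  have fin : A₂ + 4 * (A₁ + S₁) ≤ (2 * C₂) * (S₁ + S₂ + β ^ 2 + τ ^ 2) := by
    have h1 : c₀ * (4 * A₁ + A₂) ≤ C₁ * (S₁ + S₂) + (K * (β + τ)) ^ 2 / d := by
      have h2 : c₀ * A₁ ≤ d * lamp / 8 * A₁ := mul_le_mul_of_nonneg_right (min_le_left _ _) hA₁0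
      have h3 : c₀ * A₂ ≤ d / 4 * A₂ := mul_le_mul_of_nonneg_right (min_le_right _ _) hA₂0
      linarith
    have h2 : 4 * A₁ + A₂ ≤ (C₁ * (S₁ + S₂) + (K * (β + τ)) ^ 2 / d) / c₀ := by
      rw [le_div_iff₀ hc₀0]
      linarith
    have e : (C₁ * (S₁ + S₂) + (K * (β + τ)) ^ 2 / d) / c₀
        = C₁ / c₀ * (S₁ + S₂) + (K : ℝ) ^ 2 / d / c₀ * (β + τ) ^ 2 := by
      field_simp
    have h3 : (β + τ) ^ 2 ≤ 2 * (β ^ 2 + τ ^ 2) := by nlinarith [sq_nonneg (β - τ)]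
    have a1 : 0 ≤ C₁ / c₀ := by positivity
    have a2 : 0 ≤ (K : ℝ) ^ 2 / d / c₀ := by positivity
    have h4 := mul_le_mul_of_nonneg_left h3 a2
    have h5 : C₁ / c₀ ≤ C₂ := by linarith
    have h6 : (K : ℝ) ^ 2 / d / c₀ ≤ C₂ := by linarith
    have h7 : 4 * S₁ + C₁ / c₀ * (S₁ + S₂) ≤ C₂ * (S₁ + S₂) := by
      have : (4 + C₁ / c₀) * (S₁ + S₂) ≤ C₂ * (S₁ + S₂) := by
        gcongr
        linarith
      linarith
    have h8 := mul_le_mul_of_nonneg_right h6 (by positivity : 0 ≤ 2 * (β ^ 2 + τ ^ 2))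
    have h9 : 0 ≤ C₂ * (S₁ + S₂) := by positivity
    linarith
  have hUα := hU.isAdmissible.memLp_of_between hα hf.le_p
  have rhs : ((2 * C₂).toNNReal : ℝ≥0∞) * (eLpNorm U₀ (ENNReal.ofReal (p + 1)) volume ^ (p + 1)
      + eLpNorm U₀ (ENNReal.ofReal (α + 1)) volume ^ (α + 1)
      + eLpNorm b 2 volume ^ 2 + tripleNorm b ^ 2)
      = ENNReal.ofReal ((2 * C₂) * (S₁ + S₂ + β ^ 2 + τ ^ 2)) := by
    rw [eLpNorm_ofReal_rpow_eq_ofReal_integral (by linarith) hU.memLp_p,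
      eLpNorm_ofReal_rpow_eq_ofReal_integral (by linarith) hUα,
      ENNReal.ofReal_mul (by positivity), ENNReal.ofReal_add (by positivity) (by positivity),
      ENNReal.ofReal_add (by positivity) (by positivity), ENNReal.ofReal_add hS₁0 hS₂0,
      ENNReal.ofReal_pow ENNReal.toReal_nonneg, ENNReal.ofReal_pow ENNReal.toReal_nonneg,
      ENNReal.ofReal_toReal hbt, ENNReal.ofReal_toReal hTt]
    rfl
  rw [rhs]
  exact (lintegral_energy_norm_le hp hU.isAdmissible hg).trans (ENNReal.ofReal_le_ofReal fin)
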